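/- Let $(A,\mathfrak m)$ be a Noetherian local ring of Krull dimension $1$ that is a hypersurface (its $\mathfrak m$-adic completion is isomorphic to $S/(f)$ with $S$ a regular local ring and $0\neq f$ in the maximal ideal of $S$; this includes all rings $A=S/(f)$ themselves) with isolated singularity ($A_{\mathfrak p}$ is regular for every prime $\mathfrak p\neq\mathfrak m$). Then for all finitely generated $A$-modules $M,N$ the length $\ell(\operatorname{Tor}_i^A(M,N))$ is finite for $i>\dim A$, and Hochster's theta invariant $$\theta^A(M,N)=\ell(\operatorname{Tor}^A_{2e+2}(M,N))-\ell(\operatorname{Tor}^A_{2e+1}(M,N)),\qquad 2e\ge\dim A,$$ does not depend on the choice of $e$. For every finitely generated $A$-module $M$ one has $$\theta^A(M,M)\le 0,$$ with equality if and only if the ranks $\dim_{A_{\mathfrak p}}M_{\mathfrak p}$ coincide for all minimal primes $\mathfrak p$ of $A$. Moreover, $\theta^A$ induces a symmetric negative semidefinite $\mathbb Q$-bilinear form on the rational reduced Grothendieck group $\underline{G_0}(A)_{\mathbb Q}=(G_0(A)/\mathbb Z[A])\otimes_{\mathbb Z}\mathbb Q$, where $G_0(A)$ is the Grothendieck group of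 finitely generated $A$-modules. -/

import Mathlib

universe u

noncomputable section

/-- A Noetherian local ring is a (local) hypersurface if its completion is the quotient of a
regular local ring by a nonzero element of the maximal ideal. Every ring of the form `S ⧸ (f)`
with `S` regular local and `0 ≠ f ∈ 𝔪_S` is one, since its completion is `Ŝ ⧸ (f)`. -/
def IsLocalHypersurface (A : Type u) [CommRing A] [IsLocalRing A] : Prop :=
  IsNoetherianRing A ∧
    ∃ (S : Type u) (_ : CommRing S) (_ : IsRegularLocalRing S) (f : S),
      f ≠ 0 ∧ f ∈ IsLocalRing.maximalIdeal S ∧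
        Nonempty (AdicCompletion (IsLocalRing.maximalIdeal A) A ≃+* S ⧸ Ideal.span {f})

/-- `A_𝔭` is regular for every non-maximal prime `𝔭` of the local ring `A`. -/
def HasIsolatedSingularity (A : Type u) [CommRing A] [IsLocalRing A] : Prop :=
  ∀ (p : Ideal A) [p.IsPrime], p ≠ IsLocalRing.maximalIdeal A →
    IsRegularLocalRing (Localization.AtPrime p)

/-- `Tor_i^A(M, N)`. -/
abbrev torModule (A : Type u) [CommRing A] (i : ℕ)
    (M : Type u) [AddCommGroup M] [Module A M] (N : Type u) [AddCommGroup N] [Module A N] :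
    ModuleCat.{u} A :=
  ((CategoryTheory.Tor (ModuleCat.{u} A) i).obj (ModuleCat.of A M)).obj (ModuleCat.of A N)

/-- `ℓ(Tor_{2e+2}^A(M, N)) - ℓ(Tor_{2e+1}^A(M, N))`, which is Hochster's `θ^A(M, N)` for any
`e` with `2e ≥ dim A`. (Meaningful when both lengths are finite.) -/
def hochsterTheta (A : Type u) [CommRing A] (e : ℕ)
    (M : Type u) [AddCommGroup M] [Module A M] (N : Type u) [AddCommGroup N] [Module A N] : ℤ :=
  ((Module.length A (torModule A (2 * e + 2) M N)).toNat : ℤ) -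
    ((Module.length A (torModule A (2 * e + 1) M N)).toNat : ℤ)

/-- The relations `[M] = [M'] + [M'']` for all short exact sequences `0 → M' → M → M'' → 0` of
finitely generated modules. -/
def G0Relations (A : Type u) [CommRing A] :
    AddSubgroup (FreeAbelianGroup (FGModuleCat.{u} A)) :=
  AddSubgroup.closure
    {x | ∃ (M' M M'' : FGModuleCat.{u} A) (f : M' →ₗ[A] M) (g : M →ₗ[A] M''),
      Function.Injective f ∧ Function.Exact f g ∧ Function.Surjective g ∧
        x = FreeAbelianGroup.of M - FreeAbelianGroup.of M' - FreeAbelianGroup.of M''}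

/-- The Grothendieck group of finitely generated `A`-modules. -/
abbrev G0 (A : Type u) [CommRing A] : Type (u + 1) :=
  FreeAbelianGroup (FGModuleCat.{u} A) ⧸ G0Relations A

/-- The class `[M]` in `G₀(A)`. -/
def G0.cls (A : Type u) [CommRing A]
    (M : Type u) [AddCommGroup M] [Module A M] [Module.Finite A M] : G0 A :=
  QuotientAddGroup.mk (FreeAbelianGroup.of (FGModuleCat.of A M))

/-- The reduced Grothendieck group `G₀(A) / ℤ[A]`. -/
abbrev ReducedG0 (A : Type u) [CommRing A] : Type (u + 1) :=
  G0 A ⧸ AddSubgroup.zmultiples (G0.cls A A)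

/-- The reduced Grothendieck group with rational coefficients. -/
abbrev RationalReducedG0 (A : Type u) [CommRing A] : Type (u + 1) :=
  TensorProduct ℤ ℚ (ReducedG0 A)

/-- The class of `M` in the reduced Grothendieck group with rational coefficients. -/
def RationalReducedG0.cls (A : Type u) [CommRing A]
    (M : Type u) [AddCommGroup M] [Module A M] [Module.Finite A M] : RationalReducedG0 A :=
  TensorProduct.tmul ℤ (1 : ℚ) (QuotientAddGroup.mk (G0.cls A M) : ReducedG0 A)

/-- `M` has the same rank `dim_{A_𝔭} M_𝔭` at all minimal primes `𝔭` of `A`. -/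
def HasConstantMinimalRank (A : Type u) [CommRing A]
    (M : Type u) [AddCommGroup M] [Module A M] : Prop :=
  ∀ p q : PrimeSpectrum A, p.asIdeal ∈ minimalPrimes A → q.asIdeal ∈ minimalPrimes A →
    Module.rankAtStalk M p = Module.rankAtStalk M q

end

/-! The completion of `A` is `S ⧸ (f)` with `S` regular local of dimension two. A module of positive
depth over it has a free first syzygy over `S`, hence comes from a matrix factorization of `f` and
is, up to free summands, its own second syzygy. This descends to `A`, because completion is
faithfully flat and does not change the residue field (`IsLocalHypersurface.exists_periodic`). Two
consequences follow: `Tor` has period two from degree two on, and an ideal `I` is principal as soon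
as `A ⧸ I` has positive depth.

Hence a minimal prime is `p = (a)`, with annihilator `(b)`. Since `A_p` is a field, `b ∉ p`, so
`(a)` is in turn the annihilator of `b`, and `A ⧸ p` is resolved by multiplication by `a` and `b`
alternately (`HasPeriodicResolutions.exists_exactPair`). The higher `Tor` of `A ⧸ p` are killed by
`(a, b)`, which lies in no minimal prime, so dévissage gives finite length. If `q ≠ p` is another
minimal prime, then `a` is regular on `A ⧸ q` and `b` acts as zero, so `θ(A/p, A/q) > 0`
(`hochsterTheta_quotient_pos`).

Theta is additive on short exact sequences: the defect is the increment, over one period, of the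
length of a connecting image; it is constant, while these lengths stay bounded. Dévissage together
with the vanishing of theta on the residue field then gives `θ(M, N) = ∑ rank_p(M) θ(A/p, N)`. As
`θ(A, N) = 0`, the symmetric matrix `w p q = θ(A/p, A/q)` has zero row sums and positive
off-diagonal entries: it is minus a weighted Laplacian of the complete graph on the minimal primes.
Therefore `-2 θ(M, N)` is the sum of `w p q` times the rank differences of `M` and of `N` between
`p` and `q` (`neg_two_mul_hochsterTheta`). Semidefiniteness, the equality case and the form on the
reduced Grothendieck group can be read off from this formula. -/

/-! ### Tor: long exact sequence, dimension shifting, symmetry, annihilators -/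

section Tor

open CategoryTheory MonoidalCategory TensorProduct

variable {A : Type u} [CommRing A]

theorem exact_conj_linearEquiv {X Y Z X' Y' Z' : Type*} [AddCommGroup X] [AddCommGroup Y]
    [AddCommGroup Z] [AddCommGroup X'] [AddCommGroup Y'] [AddCommGroup Z'] [Module A X] [Module A Y]
    [Module A Z] [Module A X'] [Module A Y'] [Module A Z'] (e₁ : X' ≃ₗ[A] X) (e₂ : Y' ≃ₗ[A] Y)
    (e₃ : Z' ≃ₗ[A] Z) (f : X →ₗ[A] Y) (g : Y →ₗ[A] Z) (h : Function.Exact f g) :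
    Function.Exact (e₂.symm.toLinearMap ∘ₗ f ∘ₗ e₁.toLinearMap)
      (e₃.symm.toLinearMap ∘ₗ g ∘ₗ e₂.toLinearMap) :=
  Function.Exact.of_ladder_linearEquiv_of_exact (e₁ := e₁.symm) (e₂ := e₂.symm) (e₃ := e₃.symm)
    (by ext; simp) (by ext; simp) h

theorem nonempty_kerCompQuotEquivKer {X Y W V : Type*} [AddCommGroup X] [AddCommGroup Y]
    [AddCommGroup W] [AddCommGroup V] [Module A X] [Module A Y] [Module A W] [Module A V]
    (f : X →ₗ[A] Y) (π : Y →ₗ[A] W) (ι : W →ₗ[A] V) (h : Function.Exact f π)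
    (hπ : Function.Surjective π) (g : Y →ₗ[A] V) (hg : ι ∘ₗ π = g) (f' : X →ₗ[A] LinearMap.ker g)
    (hf' : ∀ x, (f' x : Y) = f x) :
    Nonempty ((LinearMap.ker g ⧸ LinearMap.range f') ≃ₗ[A] LinearMap.ker ι) := by
  subst hg
  let ρ : LinearMap.ker (ι ∘ₗ π) →ₗ[A] LinearMap.ker ι :=
    (π ∘ₗ (LinearMap.ker (ι ∘ₗ π)).subtype).codRestrict _ fun x => x.2
  have hρ : LinearMap.ker ρ = LinearMap.range f' := by
    ext x
    simp only [LinearMap.mem_ker, LinearMap.mem_range]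
    refine Subtype.ext_iff.trans ((h x).trans (exists_congr fun y => ?_))
    rw [Subtype.ext_iff, hf']
  refine ⟨(Submodule.quotEquivOfEq _ _ hρ.symm).trans (ρ.quotKerEquivOfSurjective ?_)⟩
  rintro ⟨w, hw⟩
  obtain ⟨y, rfl⟩ := hπ w
  exact ⟨⟨y, hw⟩, rfl⟩

/-- `Tor` is derived in its second variable. The terms of a projective resolution of `N` are flat,
so tensoring it with the given sequence yields a short exact sequence of complexes; its homology
sequence is the one wanted. -/
theorem exists_tor_longExact
    {M' M M'' : Type u} [AddCommGroup M'] [Module A M'] [AddCommGroup M] [Module A M]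
    [AddCommGroup M''] [Module A M''] (f : M' →ₗ[A] M) (g : M →ₗ[A] M'')
    (hf : Function.Injective f) (hfg : Function.Exact f g) (hg : Function.Surjective g)
    (N : Type u) [AddCommGroup N] [Module A N] :
    ∃ (α : ∀ i, torModule A i M' N →ₗ[A] torModule A i M N)
      (β : ∀ i, torModule A i M N →ₗ[A] torModule A i M'' N)
      (δ : ∀ i, torModule A (i + 1) M'' N →ₗ[A] torModule A i M' N),
      ∀ i, Function.Exact (α i) (β i) ∧ Function.Exact (β (i + 1)) (δ i) ∧
        Function.Exact (δ i) (α i) := by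
  let P := projectiveResolution (ModuleCat.of A N)
  let φ := (tensoringLeft (ModuleCat.{u} A)).map (ModuleCat.ofHom f)
  let ψ := (tensoringLeft (ModuleCat.{u} A)).map (ModuleCat.ofHom g)
  let c := ComplexShape.down ℕ
  let Φ := (NatTrans.mapHomologicalComplex φ c).app P.complex
  let Ψ := (NatTrans.mapHomologicalComplex ψ c).app P.complex
  have hzero : Φ ≫ Ψ = 0 := by
    ext i : 1
    apply ModuleCat.hom_ext
    refine TensorProduct.ext' fun x y => ?_
    change g (f x) ⊗ₜ[A] y = 0
    rw [hfg.apply_apply_eq_zero, TensorProduct.zero_tmul]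
  let S := ShortComplex.mk Φ Ψ hzero
  have hS : S.ShortExact := by
    apply HomologicalComplex.shortExact_of_degreewise_shortExact
    intro i
    have : Module.Projective A (P.complex.X i) :=
      (IsProjective.iff_projective (P.complex.X i)).mpr (P.projective i)
    refine ShortComplex.ShortExact.mk' ?_ ?_ ?_
    · rw [ShortComplex.ShortExact.moduleCat_exact_iff_function_exact]
      exact rTensor_exact (P.complex.X i) hfg hg
    · rw [ModuleCat.mono_iff_injective]
      exact Module.Flat.rTensor_preserves_injective_linearMap (M := P.complex.X i) f hf
    · rw [ModuleCat.epi_iff_surjective]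
      exact LinearMap.rTensor_surjective (P.complex.X i) hg
  let e (X : Type u) [AddCommGroup X] [Module A X] (i : ℕ) :=
    (P.isoLeftDerivedObj ((tensoringLeft (ModuleCat.{u} A)).obj (ModuleCat.of A X)) i).toLinearEquiv
  have hij (i : ℕ) : c.Rel (i + 1) i := rfl
  refine ⟨fun i => (e M i).symm.toLinearMap ∘ₗ
      (HomologicalComplex.homologyMap Φ i).hom ∘ₗ (e M' i).toLinearMap,
    fun i => (e M'' i).symm.toLinearMap ∘ₗ
      (HomologicalComplex.homologyMap Ψ i).hom ∘ₗ (e M i).toLinearMap,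
    fun i => (e M' i).symm.toLinearMap ∘ₗ
      (hS.δ (i + 1) i (hij i)).hom ∘ₗ (e M'' (i + 1)).toLinearMap, fun i => ⟨?_, ?_, ?_⟩⟩
  · exact exact_conj_linearEquiv _ _ _ _ _
      ((ShortComplex.ShortExact.moduleCat_exact_iff_function_exact _).mp (hS.homology_exact₂ i))
  · exact exact_conj_linearEquiv _ _ _ _ _
      ((ShortComplex.ShortExact.moduleCat_exact_iff_function_exact _).mp
        (hS.homology_exact₃ (i + 1) i (hij i)))
  · exact exact_conj_linearEquiv _ _ _ _ _
      ((ShortComplex.ShortExact.moduleCat_exact_iff_function_exact _).mp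
        (hS.homology_exact₁ (i + 1) i (hij i)))

/-- The kernels of the maps `M ⊗ Z i → M ⊗ P i`, for the syzygies `Z i` in a projective resolution
`P` of `N`, compute the higher `Tor` modules. -/
theorem exists_syzygies (N : Type u) [AddCommGroup N] [Module A N] :
    ∃ (P Z : ℕ → ModuleCat.{u} A) (ι : ∀ i, Z i →ₗ[A] P i) (π : ∀ i, P (i + 1) →ₗ[A] Z i)
      (ε : P 0 →ₗ[A] N),
      (∀ i, Module.Flat A (P i)) ∧ (∀ i, Function.Injective (ι i)) ∧
      (∀ i, Function.Surjective (π i)) ∧ Function.Surjective ε ∧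
      (∀ i, Function.Exact (ι (i + 1)) (π i)) ∧ Function.Exact (ι 0) ε ∧
      ∀ (M : Type u) [AddCommGroup M] [Module A M] (i : ℕ),
        Nonempty (torModule A (i + 1) M N ≃ₗ[A] LinearMap.ker ((ι i).lTensor M)) := by
  let P := projectiveResolution (ModuleCat.of A N)
  have hP (i : ℕ) : Module.Projective A (P.complex.X i) :=
    (IsProjective.iff_projective (P.complex.X i)).mpr (P.projective i)
  let d (i : ℕ) : P.complex.X (i + 1) →ₗ[A] P.complex.X i := (P.complex.d (i + 1) i).hom
  have hd (i : ℕ) : Function.Exact (d (i + 1)) (d i) :=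
    (ShortComplex.ShortExact.moduleCat_exact_iff_function_exact _).mp (P.exact_succ i)
  refine ⟨fun i => P.complex.X i, fun i => ModuleCat.of A (LinearMap.range (d i)),
    fun i => (LinearMap.range (d i)).subtype, fun i => (d i).rangeRestrict, (P.π.f 0).hom,
    fun i => inferInstance, fun i => Subtype.val_injective, fun i => (d i).surjective_rangeRestrict,
    ?_, ?_, ?_, ?_⟩
  · exact (ModuleCat.epi_iff_surjective (P.π.f 0)).mp inferInstance
  · intro i x
    refine ⟨fun hx => ?_, fun ⟨⟨_, y, hy⟩, hx⟩ => Subtype.ext ?_⟩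
    · obtain ⟨y, hy⟩ := (hd i x).mp (congrArg Subtype.val hx)
      exact ⟨⟨x, y, hy⟩, rfl⟩
    · exact (hd i x).mpr ⟨y, hy.trans hx⟩
  · intro x
    have h₀ := (ShortComplex.ShortExact.moduleCat_exact_iff_function_exact _).mp P.exact₀
    refine (h₀ x).trans ⟨fun ⟨y, hy⟩ => ⟨⟨x, y, hy⟩, rfl⟩, fun ⟨⟨_, y, hy⟩, hx⟩ => ⟨y, hy.trans hx⟩⟩
  · intro M _ _ i
    let F := (tensoringLeft (ModuleCat.{u} A)).obj (ModuleCat.of A M)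
    let C := (F.mapHomologicalComplex (ComplexShape.down ℕ)).obj P.complex
    let e₁ := P.isoLeftDerivedObj F (i + 1)
    let e₂ := ShortComplex.homologyMapIso (C.isoSc' (i + 2) (i + 1) i (by simp) (by simp))
    let e₃ := (C.sc' (i + 2) (i + 1) i).moduleCatHomologyIso
    have hfac : ((LinearMap.range (d i)).subtype.lTensor M) ∘ₗ (d i).rangeRestrict.lTensor M =
        (d i).lTensor M := by
      rw [← LinearMap.lTensor_comp]; rfl
    have hex : Function.Exact ((d (i + 1)).lTensor M) ((d i).rangeRestrict.lTensor M) := by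
      refine lTensor_exact M ?_ (d i).surjective_rangeRestrict
      intro x
      rw [← hd i x]
      exact Subtype.ext_iff
    obtain ⟨e₄⟩ := nonempty_kerCompQuotEquivKer ((d (i + 1)).lTensor M) ((d i).rangeRestrict.lTensor M)
      ((LinearMap.range (d i)).subtype.lTensor M) hex
      (LinearMap.lTensor_surjective M (d i).surjective_rangeRestrict)
      ((d i).lTensor M) hfac (C.sc' (i + 2) (i + 1) i).moduleCatToCycles (fun x => rfl)
    exact ⟨(e₁ ≪≫ e₂ ≪≫ e₃).toLinearEquiv ≪≫ₗ e₄⟩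

variable {M N K F : Type u} [AddCommGroup M] [Module A M] [AddCommGroup N] [Module A N]
  [AddCommGroup K] [Module A K] [AddCommGroup F] [Module A F]

theorem subsingleton_tor_of_flat [Module.Flat A F] (i : ℕ) (N : Type u) [AddCommGroup N]
    [Module A N] : Subsingleton (torModule A (i + 1) F N) := by
  obtain ⟨P, Z, ι, π, ε, -, hι, -, -, -, -, h⟩ := exists_syzygies (A := A) N
  obtain ⟨e⟩ := h F i
  have : LinearMap.ker ((ι i).lTensor F) = ⊥ :=
    LinearMap.ker_eq_bot.mpr (Module.Flat.lTensor_preserves_injective_linearMap _ (hι i))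
  rw [this] at e
  exact e.toEquiv.subsingleton

theorem nonempty_tor_equiv_of_equiv {M' : Type u} [AddCommGroup M'] [Module A M']
    (e : M ≃ₗ[A] M') (i : ℕ) (N : Type u) [AddCommGroup N] [Module A N] :
    Nonempty (torModule A i M N ≃ₗ[A] torModule A i M' N) :=
  ⟨(((Tor (ModuleCat.{u} A) i).mapIso e.toModuleIso).app (ModuleCat.of A N)).toLinearEquiv⟩

theorem nonempty_tor_succ_equiv [Module.Flat A F] {k : K →ₗ[A] F} {p : F →ₗ[A] M}
    (hk : Function.Injective k) (hkp : Function.Exact k p) (hp : Function.Surjective p) (i : ℕ)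
    (N : Type u) [AddCommGroup N] [Module A N] :
    Nonempty (torModule A (i + 2) M N ≃ₗ[A] torModule A (i + 1) K N) := by
  obtain ⟨α, β, δ, h⟩ := exists_tor_longExact k p hk hkp hp N
  have := subsingleton_tor_of_flat (A := A) (F := F) i N
  have := subsingleton_tor_of_flat (A := A) (F := F) (i + 1) N
  refine ⟨LinearEquiv.ofBijective (δ (i + 1)) ⟨?_, fun y => ?_⟩⟩
  · refine (injective_iff_map_eq_zero _).mpr fun x hx => ?_
    obtain ⟨y, rfl⟩ := ((h (i + 1)).2.1 x).mp hx
    rw [Subsingleton.elim y 0, map_zero]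
  · exact ((h (i + 1)).2.2 y).mp (Subsingleton.elim _ _)

/-- Snake lemma for the sequence `K → F → M` tensored with `ι : Z → P`: the middle kernel vanishes
since `F` is flat, and the first two cokernels are `K ⊗ N` and `F ⊗ N`. This is the balancing of
`Tor` in degree one. -/
theorem nonempty_ker_lTensor_equiv_ker_rTensor {Z P : Type*} [AddCommGroup Z] [Module A Z]
    [AddCommGroup P] [Module A P] [Module.Flat A F] [Module.Flat A P]
    {k : K →ₗ[A] F} {p : F →ₗ[A] M}
    (hk : Function.Injective k) (hkp : Function.Exact k p) (hp : Function.Surjective p)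
    {ι : Z →ₗ[A] P} {ε : P →ₗ[A] N}
    (hι : Function.Injective ι) (hιε : Function.Exact ι ε) (hε : Function.Surjective ε) :
    Nonempty (LinearMap.ker (ι.lTensor M) ≃ₗ[A] LinearMap.ker (k.rTensor N)) := by
  have hK₂ : Function.Exact (0 : Unit →ₗ[A] F ⊗[A] Z) (ι.lTensor F) := by
    intro x
    have := Module.Flat.lTensor_preserves_injective_linearMap (M := F) ι hι
    rw [map_eq_zero_iff _ this]
    exact ⟨fun h => ⟨0, by simp [h]⟩, fun ⟨_, h⟩ => by simpa using h.symm⟩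
  have hK₃ : Function.Exact (LinearMap.ker (ι.lTensor M)).subtype (ι.lTensor M) :=
    LinearMap.exact_subtype_ker_map _
  have sq (X Y : Type u) [AddCommGroup X] [Module A X] [AddCommGroup Y] [Module A Y]
      (f : X →ₗ[A] Y) : (f.rTensor P).comp (ι.lTensor X) = (ι.lTensor Y).comp (f.rTensor Z) := by
    ext; simp
  have hf := rTensor_exact Z hkp hp
  have hg := rTensor_exact P hkp hp
  have hf₂ := LinearMap.rTensor_surjective Z hp
  have hg₁ := Module.Flat.rTensor_preserves_injective_linearMap (M := P) k hk
  have hπ₁ := lTensor_exact K hιε hε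
  have hπ₂ := lTensor_exact F hιε hε
  let δ := SnakeLemma.δ' (ι.lTensor K) (ι.lTensor F) (ι.lTensor M) (k.rTensor Z) (p.rTensor Z) hf
    (k.rTensor P) (p.rTensor P) hg (sq _ _ k) (sq _ _ p) _ hK₃ (ε.lTensor K) hπ₁ hf₂ hg₁
  have h₁ : Function.Exact (0 : Unit →ₗ[A] LinearMap.ker (ι.lTensor M)) δ :=
    SnakeLemma.exact_δ'_right (ι.lTensor K) (ι.lTensor F) (ι.lTensor M) (k.rTensor Z)
      (p.rTensor Z) hf (k.rTensor P) (p.rTensor P) hg (sq _ _ k) (sq _ _ p) 0 hK₂ _ hK₃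
      (ε.lTensor K) hπ₁ hf₂ hg₁ 0 (by simp) Subtype.val_injective
  have h₂ : Function.Exact δ (k.rTensor N) :=
    SnakeLemma.exact_δ'_left (ι.lTensor K) (ι.lTensor F) (ι.lTensor M) (k.rTensor Z)
      (p.rTensor Z) hf (k.rTensor P) (p.rTensor P) hg (sq _ _ k) (sq _ _ p) _ hK₃
      (ε.lTensor K) hπ₁ (ε.lTensor F) hπ₂ hf₂ hg₁ (k.rTensor N) (by ext; simp)
      (LinearMap.lTensor_surjective K hε)
  have hδ : Function.Injective δ := by
    refine (injective_iff_map_eq_zero _).mpr fun x hx => ?_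
    obtain ⟨y, rfl⟩ := (h₁ x).mp hx
    simp
  exact ⟨(LinearEquiv.ofInjective δ hδ).trans (LinearEquiv.ofEq _ _ h₂.linearMap_ker_eq.symm)⟩

theorem nonempty_tor_one_equiv [Module.Flat A F] {k : K →ₗ[A] F} {p : F →ₗ[A] M}
    (hk : Function.Injective k) (hkp : Function.Exact k p) (hp : Function.Surjective p)
    (N : Type u) [AddCommGroup N] [Module A N] :
    Nonempty (torModule A 1 M N ≃ₗ[A] LinearMap.ker (k.rTensor N)) := by
  obtain ⟨P, Z, ι, π, ε, hP, hι, -, hε, -, hιε, h⟩ := exists_syzygies (A := A) N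
  obtain ⟨e⟩ := h M 0
  have := hP 0
  obtain ⟨e'⟩ := nonempty_ker_lTensor_equiv_ker_rTensor hk hkp hp (hι 0) hιε hε
  exact ⟨e.trans e'⟩

/-- One resolution of `N` serves both sides. Shifting along its syzygies in the first variable
reduces `Tor (N, M)` to the kernel of `Z i ⊗ M → P i ⊗ M`, and swapping the factors gives the kernel
that computes `Tor (M, N)`. -/
theorem nonempty_tor_comm (M N : Type u) [AddCommGroup M] [Module A M] [AddCommGroup N]
    [Module A N] (i : ℕ) :
    Nonempty (torModule A (i + 1) M N ≃ₗ[A] torModule A (i + 1) N M) := by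
  obtain ⟨P, Z, ι, π, ε, hP, hι, hπ, hε, hex, hex₀, h⟩ := exists_syzygies (A := A) N
  have shift (i : ℕ) : ∀ j n, n = i + j →
      Nonempty (torModule A (n + 2) N M ≃ₗ[A] torModule A (j + 1) (Z i) M) := by
    induction i with
    | zero =>
      intro j n hn
      obtain rfl : n = j := by omega
      exact nonempty_tor_succ_equiv (hι 0) hex₀ hε n M
    | succ i ih =>
      intro j n hn
      obtain ⟨e⟩ := ih (j + 1) n (by omega)
      obtain ⟨e'⟩ := nonempty_tor_succ_equiv (hι (i + 1)) (hex i) (hπ i) j M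
      exact ⟨e.trans e'⟩
  have key : Nonempty (torModule A (i + 1) N M ≃ₗ[A] LinearMap.ker ((ι i).rTensor M)) := by
    cases i with
    | zero => exact nonempty_tor_one_equiv (hι 0) hex₀ hε M
    | succ i =>
      obtain ⟨e⟩ := shift i 0 i rfl
      obtain ⟨e'⟩ := nonempty_tor_one_equiv (hι (i + 1)) (hex i) (hπ i) M
      exact ⟨e.trans e'⟩
  obtain ⟨e⟩ := h M i
  obtain ⟨e'⟩ := key
  have hmap : (LinearMap.ker ((ι i).lTensor M)).map (TensorProduct.comm A M (Z i)).toLinearMap =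
      LinearMap.ker ((ι i).rTensor M) := by
    ext x
    rw [Submodule.mem_map_equiv, LinearMap.mem_ker, LinearMap.mem_ker,
      ← LinearMap.comm_comp_rTensor_comp_comm_eq]
    simp
  exact ⟨e.trans (((TensorProduct.comm A M (Z i)).submoduleMap _).trans
    ((LinearEquiv.ofEq _ _ hmap).trans e'.symm))⟩

theorem smul_tor_one_quotient_eq_zero (I : Ideal A) (N : Type u) [AddCommGroup N] [Module A N]
    {r : A} (hr : r ∈ I) (x : torModule A 1 (A ⧸ I) N) : r • x = 0 := by
  obtain ⟨e⟩ := nonempty_tor_one_equiv (A := A) (k := I.subtype) (p := I.mkQ)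
    Subtype.val_injective (LinearMap.exact_subtype_mkQ I) I.mkQ_surjective N
  -- Multiplication by `r ∈ I` on `I ⊗ N` factors through `I ⊗ N → N`, whose kernel is `Tor₁`.
  have key (z : I ⊗[A] N) :
      r • z = (⟨r, hr⟩ : I) ⊗ₜ[A] TensorProduct.lid A N (I.subtype.rTensor N z) := by
    induction z with
    | zero => simp
    | add x y hx hy => rw [smul_add, hx, hy, map_add, map_add, TensorProduct.tmul_add]
    | tmul a n =>
      rw [LinearMap.rTensor_tmul, TensorProduct.lid_tmul, Submodule.subtype_apply,
        ← TensorProduct.smul_tmul, TensorProduct.smul_tmul']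
      congr 1
      ext
      exact mul_comm _ _
  apply e.injective
  rw [map_smul, map_zero]
  ext
  rw [Submodule.coe_smul, key, (e x).2, map_zero, TensorProduct.tmul_zero, Submodule.coe_zero]

/-- By symmetry `A ⧸ I` may stand in the second variable, so that dimension shifting replaces `N` by
a syzygy and leaves `I` alone. -/
theorem smul_tor_quotient_eq_zero (I : Ideal A) (i : ℕ) (N : Type u) [AddCommGroup N] [Module A N]
    {r : A} (hr : r ∈ I) (x : torModule A (i + 1) (A ⧸ I) N) : r • x = 0 := by
  suffices h : ∀ x : torModule A (i + 1) N (A ⧸ I), r • x = 0 by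
    obtain ⟨e⟩ := nonempty_tor_comm (A := A) (A ⧸ I) N i
    apply e.injective
    rw [map_smul, h, map_zero]
  clear x
  induction i generalizing N with
  | zero =>
    intro x
    obtain ⟨e⟩ := nonempty_tor_comm (A := A) N (A ⧸ I) 0
    apply e.injective
    rw [map_smul, smul_tor_one_quotient_eq_zero I N hr, map_zero]
  | succ i ih =>
    intro x
    obtain ⟨F, _, _, _, p, hp⟩ : ∃ (F : Type u) (_ : AddCommGroup F) (_ : Module A F)
        (_ : Module.Flat A F) (p : F →ₗ[A] N), Function.Surjective p :=
      ⟨N →₀ A, inferInstance, inferInstance, inferInstance, Finsupp.linearCombination A id,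
        Finsupp.linearCombination_id_surjective A N⟩
    obtain ⟨e⟩ := nonempty_tor_succ_equiv (k := (LinearMap.ker p).subtype) (p := p)
      Subtype.val_injective (LinearMap.exact_subtype_ker_map p) hp i (A ⧸ I)
    apply e.injective
    rw [map_smul, ih, map_zero]

theorem finite_tor [IsNoetherianRing A] (i : ℕ) (M N : Type u) [AddCommGroup M] [Module A M]
    [Module.Finite A M] [AddCommGroup N] [Module A N] [Module.Finite A N] :
    Module.Finite A (torModule A (i + 1) M N) := by
  induction i generalizing M with
  | zero =>
    obtain ⟨n, p, hp⟩ := Module.Finite.exists_fin' A M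
    obtain ⟨e⟩ := nonempty_tor_one_equiv (k := (LinearMap.ker p).subtype) (p := p)
      Subtype.val_injective (LinearMap.exact_subtype_ker_map p) hp N
    have : IsNoetherian A (LinearMap.ker p ⊗[A] N) :=
      isNoetherian_of_isNoetherianRing_of_finite A (LinearMap.ker p ⊗[A] N)
    exact Module.Finite.equiv e.symm
  | succ i ih =>
    obtain ⟨n, p, hp⟩ := Module.Finite.exists_fin' A M
    obtain ⟨e⟩ := nonempty_tor_succ_equiv (k := (LinearMap.ker p).subtype) (p := p)
      Subtype.val_injective (LinearMap.exact_subtype_ker_map p) hp i N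
    have := ih (LinearMap.ker p)
    exact Module.Finite.equiv e.symm

end Tor

/-! ### Regular local rings of dimension two and matrix factorizations -/

section RegularDimTwo

open IsLocalRing
open scoped Pointwise

/-- By Krull's intersection theorem each nonzero element is a power of `v` times a unit, so a zero
product of two such elements would make `v` nilpotent. -/
theorem IsLocalRing.isDomain_of_maximalIdeal_eq_span_singleton {R : Type*} [CommRing R]
    [IsLocalRing R] [IsNoetherianRing R] {v : R} (hm : maximalIdeal R = Ideal.span {v})
    (hv : ¬ IsNilpotent v) : IsDomain R := by
  have key (x : R) (hx : x ≠ 0) : ∃ (n : ℕ) (c : R), IsUnit c ∧ x = v ^ n * c := by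
    have h : ∃ n, x ∉ maximalIdeal R ^ n := by
      by_contra! h
      exact hx (by simpa [Ideal.iInf_pow_eq_bot_of_isLocalRing _ (maximalIdeal.isMaximal R).ne_top]
        using Ideal.mem_iInf.mpr h)
    classical
    obtain ⟨n, hn⟩ : ∃ n, Nat.find h = n + 1 := by
      refine Nat.exists_eq_succ_of_ne_zero fun h0 => ?_
      have := Nat.find_spec h
      rw [h0] at this
      simp at this
    have h₁ := Nat.find_spec h
    have h₂ : x ∈ maximalIdeal R ^ n := by
      by_contra h'
      exact absurd (Nat.find_min' h h') (by omega)
    rw [hm, Ideal.span_singleton_pow, Ideal.mem_span_singleton'] at h₂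
    obtain ⟨c, rfl⟩ := h₂
    refine ⟨n, c, ?_, mul_comm _ _⟩
    by_contra hc
    refine h₁ ?_
    rw [hn, pow_succ']
    refine Ideal.mul_mem_mul ?_ ?_
    · exact (mem_maximalIdeal c).mpr hc
    · exact Ideal.pow_mem_pow (hm ▸ Ideal.mem_span_singleton_self v) n
  have : NoZeroDivisors R := by
    refine ⟨fun {x y} hxy => ?_⟩
    by_contra! h
    obtain ⟨n, c, hc, rfl⟩ := key x h.1
    obtain ⟨k, d, hd, rfl⟩ := key y h.2
    refine hv ⟨n + k, ?_⟩
    rw [← (hc.mul hd).mul_left_eq_zero, ← hxy]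
    ring
  exact NoZeroDivisors.to_isDomain R

variable {S : Type u} [CommRing S] [IsRegularLocalRing S]

/-- A regular local ring of dimension two is a domain, and its maximal ideal is generated by `u, v`
with `u` prime and `v ∉ (u)`. -/
theorem IsRegularLocalRing.exists_prime_span_pair (hS : ringKrullDim S = 2) :
    ∃ u v : S, maximalIdeal S = Ideal.span {u, v} ∧ Prime u ∧ ¬ u ∣ v ∧ IsDomain S := by
  have hheight : (maximalIdeal S).height = 2 := by
    have := maximalIdeal_height_eq_ringKrullDim (R := S)
    rw [hS] at this
    exact WithBot.coe_injective this
  obtain ⟨s, t, hst⟩ : ∃ s t : S, maximalIdeal S = Ideal.span {s, t} := by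
    have h2 : (maximalIdeal S).spanFinrank = 2 := by
      have := IsRegularLocalRing.spanFinrank_maximalIdeal (R := S)
      rw [hS] at this
      exact_mod_cast this
    obtain ⟨F, hF, hspan⟩ := Submodule.FG.exists_span_finset_card_eq_spanFinrank
      (maximalIdeal S).fg_of_isNoetherianRing
    classical
    obtain ⟨s, t, -, rfl⟩ := Finset.card_eq_two.mp (hF.trans h2)
    exact ⟨s, t, by rw [← hspan]; simp [Ideal.span]⟩
  -- Prime avoidance, with the square of the maximal ideal as the one ideal that need not be prime.
  -- Containment in the square is excluded by Nakayama, containment in a minimal prime by the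
  -- height.
  obtain ⟨u, hum, hu2, humin⟩ : ∃ u ∈ maximalIdeal S, u ∉ maximalIdeal S ^ 2 ∧
      ∀ q ∈ minimalPrimes S, u ∉ q := by
    by_contra! h
    have hfin : (insert (maximalIdeal S ^ 2) (minimalPrimes S)).Finite :=
      (minimalPrimes.finite_of_isNoetherianRing S).insert _
    obtain ⟨I, hI, hle⟩ := (Ideal.subset_union_prime_finite hfin (f := id) (I := maximalIdeal S)
      (maximalIdeal S ^ 2) (maximalIdeal S ^ 2) (by
        rintro i (rfl | hi) h1 _
        · exact absurd rfl h1
        · exact hi.1.1)).mp (by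
        intro x hx
        by_cases hx2 : x ∈ maximalIdeal S ^ 2
        · exact Set.mem_biUnion (Set.mem_insert _ _) hx2
        · obtain ⟨q, hq, hxq⟩ := h x hx hx2
          exact Set.mem_biUnion (Set.mem_insert_of_mem _ hq) hxq)
    rcases hI with rfl | hI
    · have hbot : maximalIdeal S = ⊥ := by
        refine Submodule.eq_bot_of_le_smul_of_le_jacobson_bot (maximalIdeal S) _
          (maximalIdeal S).fg_of_isNoetherianRing ?_ (maximalIdeal_le_jacobson _)
        simpa [pow_two] using hle
      have : (maximalIdeal S).height = 0 := by
        rw [Ideal.height_eq_zero_iff]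
        exact ⟨⟨inferInstance, bot_le⟩, fun q _ _ => hbot ▸ bot_le⟩
      rw [hheight] at this
      exact absurd this (by norm_num)
    · have hI' : I = maximalIdeal S :=
        le_antisymm (le_maximalIdeal hI.1.1.ne_top) hle
      rw [hI', ← Ideal.height_eq_zero_iff, hheight] at hI
      exact absurd hI (by norm_num)
  obtain ⟨v, huv⟩ : ∃ v, maximalIdeal S = Ideal.span {u, v} := by
    have hum' := hum
    rw [hst, Ideal.mem_span_pair] at hum'
    obtain ⟨a, b, hab⟩ := hum'
    have hs : s ∈ maximalIdeal S := hst ▸ Ideal.subset_span (by simp)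
    have ht : t ∈ maximalIdeal S := hst ▸ Ideal.subset_span (by simp)
    have hunit : IsUnit a ∨ IsUnit b := by
      by_contra! h
      refine hu2 ?_
      rw [← hab, pow_two]
      exact add_mem (Ideal.mul_mem_mul ((mem_maximalIdeal a).mpr h.1) hs)
        (Ideal.mul_mem_mul ((mem_maximalIdeal b).mpr h.2) ht)
    rcases hunit with ha | hb
    · obtain ⟨a', ha'⟩ := ha.exists_left_inv
      refine ⟨t, le_antisymm ?_ ?_⟩
      · rw [hst, Ideal.span_le]
        rintro x (rfl | rfl)
        · refine Ideal.mem_span_pair.mpr ⟨a', -(a' * b), ?_⟩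
          rw [← hab]; linear_combination x * ha'
        · exact Ideal.subset_span (by simp)
      · rw [Ideal.span_le]
        rintro x (rfl | rfl)
        · exact hum
        · exact ht
    · obtain ⟨b', hb'⟩ := hb.exists_left_inv
      refine ⟨s, le_antisymm ?_ ?_⟩
      · rw [hst, Ideal.span_le]
        rintro x (rfl | rfl)
        · exact Ideal.subset_span (by simp)
        · refine Ideal.mem_span_pair.mpr ⟨b', -(b' * a), ?_⟩
          rw [← hab]; linear_combination x * hb'
      · rw [Ideal.span_le]
        rintro x (rfl | rfl)
        · exact hum
        · exact hs
  have hvm : v ∈ maximalIdeal S := huv ▸ Ideal.subset_span (by simp)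
  have hune : Ideal.span {u} ≠ ⊤ := by
    rw [Ne, Ideal.span_singleton_eq_top]
    exact (mem_maximalIdeal u).mp hum
  -- Otherwise the maximal ideal would be minimal over `(u)`, against Krull's principal ideal
  -- theorem.
  have hvn (n : ℕ) : v ^ n ∉ Ideal.span {u} := by
    intro h
    have : maximalIdeal S ∈ (Ideal.span {u}).minimalPrimes := by
      refine ⟨⟨inferInstance, by simpa [Ideal.span_le] using hum⟩, fun q hq _ => ?_⟩
      have := hq.1
      rw [huv, Ideal.span_le]
      rintro x (rfl | rfl)
      · exact hq.2 (Ideal.mem_span_singleton_self _)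
      · exact hq.1.mem_of_pow_mem n (hq.2 h)
    have := Ideal.height_le_one_of_isPrincipal_of_mem_minimalPrimes _ _ this
    rw [hheight] at this
    exact absurd this (by norm_num)
  have hdom : IsDomain (S ⧸ Ideal.span {u}) := by
    have : Nontrivial (S ⧸ Ideal.span {u}) := Ideal.Quotient.nontrivial_iff.mpr hune
    have : IsLocalRing (S ⧸ Ideal.span {u}) :=
      IsLocalRing.of_surjective' _ Ideal.Quotient.mk_surjective
    refine isDomain_of_maximalIdeal_eq_span_singleton (v := Ideal.Quotient.mk _ v) ?_ ?_
    · have : (maximalIdeal S).map (Ideal.Quotient.mk (Ideal.span {u})) =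
        maximalIdeal (S ⧸ Ideal.span {u}) := by
        refine ((IsLocalRing.eq_maximalIdeal ?_))
        refine (Ideal.map_eq_top_or_isMaximal_of_surjective _ Ideal.Quotient.mk_surjective
          inferInstance).resolve_left fun h => ?_
        have h1 : (1 : S ⧸ Ideal.span {u}) ∈ (maximalIdeal S).map (Ideal.Quotient.mk _) :=
          h ▸ trivial
        obtain ⟨y, hy, hy1⟩ := (Ideal.mem_map_iff_of_surjective _
          Ideal.Quotient.mk_surjective).mp h1
        have : y - 1 ∈ maximalIdeal S := by
          have : y - 1 ∈ Ideal.span {u} := Ideal.Quotient.eq.mp (by simpa using hy1)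
          exact (Ideal.span_le.mpr (by simpa using hum)) this
        exact (maximalIdeal.isMaximal S).ne_top
          ((Ideal.eq_top_iff_one _).mpr (by simpa using sub_mem hy this))
      rw [← this, huv, Ideal.map_span, Set.image_pair,
        Ideal.Quotient.eq_zero_iff_mem.mpr (Ideal.mem_span_singleton_self u),
        Ideal.span_pair_eq_span_right_iff_dvd.mpr]
      exact dvd_zero _
    · rintro ⟨n, hn⟩
      rw [← map_pow, Ideal.Quotient.eq_zero_iff_mem] at hn
      exact hvn n hn
  have hprime : (Ideal.span {u}).IsPrime := (Ideal.Quotient.isDomain_iff_prime _).mp hdom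
  -- A minimal prime `q ⊆ (u)` does not contain `u`, so `q = u q` and Nakayama gives `q = 0`.
  have hSdom : IsDomain S := by
    obtain ⟨q, hq, hqu⟩ := Ideal.exists_minimalPrimes_le (I := ⊥) (J := Ideal.span {u}) bot_le
    have hqp : q.IsPrime := hq.1.1
    have : q = ⊥ := by
      refine Submodule.eq_bot_of_le_smul_of_le_jacobson_bot (maximalIdeal S) _
        q.fg_of_isNoetherianRing (fun x hx => ?_) (maximalIdeal_le_jacobson _)
      obtain ⟨y, rfl⟩ := Ideal.mem_span_singleton'.mp (hqu hx)
      rw [mul_comm]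
      exact Submodule.smul_mem_smul hum
        ((hqp.mem_or_mem hx).resolve_right (humin q hq))
    subst this
    exact (IsDomain.of_bot_isPrime S)
  refine ⟨u, v, huv, ?_, ?_, hSdom⟩
  · refine (Ideal.span_singleton_prime ?_).mp hprime
    rintro rfl
    exact hu2 (zero_mem _)
  · rw [← Ideal.mem_span_singleton]
    simpa using hvn 1

/-- Over a regular local ring of dimension two, the first syzygy of a module of positive depth is
free. -/
theorem IsRegularLocalRing.free_ker_of_isSMulRegular (hS : ringKrullDim S = 2) {F X : Type*}
    [AddCommGroup F] [Module S F] [Module.Free S F] [Module.Finite S F] [AddCommGroup X]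
    [Module S X] (p : F →ₗ[S] X) {y : S} (hy : y ∈ maximalIdeal S)
    (hreg : IsSMulRegular X y) : Module.Free S (LinearMap.ker p) := by
  obtain ⟨u, v, huv, hu, hv, _⟩ := IsRegularLocalRing.exists_prime_span_pair hS
  have hum : u ∈ maximalIdeal S := huv ▸ Ideal.subset_span (by simp)
  have hvm : v ∈ maximalIdeal S := huv ▸ Ideal.subset_span (by simp)
  have huF {x : F} (hx : u • x = 0) : x = 0 := (smul_eq_zero.mp hx).resolve_left hu.ne_zero
  have hdiv {x z : F} (h : v • x = u • z) : ∃ w, x = u • w := by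
    let b := Module.Free.chooseBasis S F
    have hcoord (i) : u ∣ b.repr x i := by
      have := congrArg (fun t => b.repr t i) h
      simp only [map_smul, Finsupp.smul_apply, smul_eq_mul] at this
      exact (hu.dvd_or_dvd ⟨_, this⟩).resolve_left hv
    choose c hc using hcoord
    refine ⟨∑ i, c i • b i, ?_⟩
    rw [Finset.smul_sum, ← b.sum_repr x]
    exact Finset.sum_congr rfl fun i _ => by rw [hc i, mul_smul]
  have hKu : IsSMulRegular (LinearMap.ker p) u := by
    rw [isSMulRegular_iff_right_eq_zero_of_smul]
    exact fun m hm => Subtype.ext (huF (congrArg Subtype.val hm))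
  have : Module.FinitePresentation S (LinearMap.ker p) := Module.finitePresentation_of_finite S _
  -- Since `u, v` turns out to be regular on the kernel, freeness may be tested after killing `u`
  -- and then `v`, that is, over a field.
  rw [← Module.free_quotSMulTop_iff_free S (LinearMap.ker p)
    (maximalIdeal_le_jacobson _ hum) hKu]
  let Q := S ⧸ Ideal.span {u}
  let v' : Q := Ideal.Quotient.mk _ v
  have hune : Ideal.span {u} ≠ ⊤ := by
    rw [Ne, Ideal.span_singleton_eq_top]
    exact hu.not_isUnit
  have : Nontrivial Q := Ideal.Quotient.nontrivial_iff.mpr hune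
  have : IsLocalRing Q := IsLocalRing.of_surjective' _ Ideal.Quotient.mk_surjective
  have : Module.Finite Q (QuotSMulTop u (LinearMap.ker p)) :=
    Module.Finite.of_restrictScalars_finite S _ _
  have hKv : IsSMulRegular (QuotSMulTop u (LinearMap.ker p)) v' := by
    rw [isSMulRegular_iff_right_eq_zero_of_smul]
    intro m hm
    obtain ⟨⟨x, hx⟩, rfl⟩ := Submodule.mkQ_surjective _ m
    have h1 : v • (⟨x, hx⟩ : LinearMap.ker p) ∈ u • (⊤ : Submodule S (LinearMap.ker p)) := by
      rw [← Submodule.Quotient.mk_eq_zero]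
      exact hm
    obtain ⟨⟨z, hz⟩, -, hz'⟩ := (Submodule.mem_smul_pointwise_iff_exists _ _ _).mp h1
    have h2 : v • x = u • z := (congrArg Subtype.val hz').symm
    obtain ⟨w, rfl⟩ := hdiv h2
    have h3 : v • w = z := by
      have : u • (v • w - z) = 0 := by rw [smul_sub, ← h2, smul_comm, sub_self]
      exact sub_eq_zero.mp (huF this)
    -- The depth of `X` enters here: `u` and `v` both kill `p w`, hence so does `y ∈ (u, v)`, which
    -- is regular on `X`.
    have h4 : p w = 0 := by
      refine hreg.right_eq_zero_of_smul ?_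
      rw [huv, Ideal.mem_span_pair] at hy
      obtain ⟨a, b, rfl⟩ := hy
      rw [add_smul, mul_smul, mul_smul, ← map_smul p u, ← map_smul p v, h3,
        LinearMap.mem_ker.mp hx, LinearMap.mem_ker.mp hz, smul_zero, smul_zero, add_zero]
    rw [Submodule.mkQ_apply, Submodule.Quotient.mk_eq_zero]
    exact (Submodule.mem_smul_pointwise_iff_exists _ _ _).mpr ⟨⟨w, h4⟩, trivial, rfl⟩
  have hv' : v' ∈ maximalIdeal Q := by
    rw [mem_maximalIdeal, mem_nonunits_iff]
    intro hunit
    obtain ⟨w, hw⟩ := hunit.exists_right_inv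
    obtain ⟨w, rfl⟩ := Ideal.Quotient.mk_surjective w
    have : v * w - 1 ∈ Ideal.span {u} := Ideal.Quotient.eq.mp (by simpa using hw)
    have := (Ideal.span_le.mpr (by simpa using hum) : Ideal.span {u} ≤ maximalIdeal S) this
    exact (maximalIdeal.isMaximal S).ne_top ((Ideal.eq_top_iff_one _).mpr
      (by simpa using sub_mem (Ideal.mul_mem_right w _ hvm) this))
  have : Module.FinitePresentation Q (QuotSMulTop u (LinearMap.ker p)) :=
    Module.finitePresentation_of_finite Q _
  refine (Module.free_quotSMulTop_iff_free Q (QuotSMulTop u (LinearMap.ker p))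
    (maximalIdeal_le_jacobson _ hv') hKv).mp ?_
  have hmax : (Ideal.span {v'}).IsMaximal := by
    have : Ideal.span {v'} = (maximalIdeal S).map (Ideal.Quotient.mk (Ideal.span {u})) := by
      rw [huv, Ideal.map_span, Set.image_pair,
        Ideal.Quotient.eq_zero_iff_mem.mpr (Ideal.mem_span_singleton_self u),
        Ideal.span_pair_eq_span_right_iff_dvd.mpr (dvd_zero _)]
    rw [this]
    refine (Ideal.map_eq_top_or_isMaximal_of_surjective _ Ideal.Quotient.mk_surjective
      inferInstance).resolve_left fun h => ?_
    rw [← this] at h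
    exact (maximalIdeal.isMaximal Q).ne_top
      (top_le_iff.mp (h ▸ Ideal.span_le.mpr (by simpa using hv')))
  let := Ideal.Quotient.field (Ideal.span {v'})
  exact Module.Free.of_divisionRing (Q ⧸ Ideal.span {v'}) _

/-- A module of positive depth over `S ⧸ (f)`, where `S` is a regular local ring of dimension two,
is given by a matrix factorization of `f`. -/
theorem IsRegularLocalRing.exists_matrixFactorization (hS : ringKrullDim S = 2) {f : S}
    (hf : f ≠ 0) {B : Type*} [CommRing B] [Algebra S B]
    (hsurj : Function.Surjective (algebraMap S B))
    (hker : RingHom.ker (algebraMap S B) = Ideal.span {f}) {X : Type*} [AddCommGroup X]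
    [Module B X] [Module S X] [IsScalarTower S B X] {n : ℕ} (π : (Fin n → B) →ₗ[B] X)
    (hπ : Function.Surjective π) {y : S} (hy : y ∈ maximalIdeal S) (hreg : IsSMulRegular X y) :
    ∃ φ : (Fin n → B) →ₗ[B] (Fin n → B), LinearMap.range φ = LinearMap.ker π ∧
      Nonempty (LinearMap.ker φ ≃ₗ[B] X) := by
  obtain ⟨-, -, -, -, -, _⟩ := IsRegularLocalRing.exists_prime_span_pair hS
  let σ : (Fin n → S) →ₗ[S] (Fin n → B) := (Algebra.linearMap S B).compLeft (Fin n)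
  have hσ_apply (g : Fin n → S) : σ g = algebraMap S B ∘ g := rfl
  have hσ : Function.Surjective σ := hsurj.comp_left
  have hσ0 (g : Fin n → S) : σ g = 0 ↔ ∃ h, g = f • h := by
    refine ⟨fun hg => ?_, ?_⟩
    · have hdvd (i : Fin n) : f ∣ g i := by
        rw [← Ideal.mem_span_singleton, ← hker]
        exact congrFun hg i
      choose h hh using hdvd
      exact ⟨h, funext hh⟩
    · rintro ⟨h, rfl⟩
      have : algebraMap S B f = 0 := by
        rw [← RingHom.mem_ker, hker]; exact Ideal.mem_span_singleton_self f
      rw [map_smul]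
      ext i
      rw [Pi.smul_apply, Algebra.smul_def, this, zero_mul, Pi.zero_apply]
  let p : (Fin n → S) →ₗ[S] X := π.restrictScalars S ∘ₗ σ
  have := IsRegularLocalRing.free_ker_of_isSMulRegular hS p hy hreg
  have hfmem (g : Fin n → S) : f • g ∈ LinearMap.ker p := by
    rw [LinearMap.mem_ker]
    change π (σ (f • g)) = 0
    rw [(hσ0 _).mpr ⟨g, rfl⟩, map_zero]
  have hfinj {g h : Fin n → S} (H : f • g = f • h) : g = h := smul_right_injective _ hf H
  let μ : (Fin n → S) →ₗ[S] LinearMap.ker p :=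
    (LinearMap.lsmul S (Fin n → S) f).codRestrict _ hfmem
  -- The kernel lies between `f • Sⁿ` and `Sⁿ`.
  have hrank : Module.finrank S (LinearMap.ker p) = n := by
    refine le_antisymm ?_ ?_
    · simpa using LinearMap.finrank_le_finrank_of_injective (f := (LinearMap.ker p).subtype)
        Subtype.val_injective
    · simpa using LinearMap.finrank_le_finrank_of_injective (f := μ)
        fun g h H => hfinj (congrArg Subtype.val H)
  let e : (Fin n → S) ≃ₗ[S] LinearMap.ker p :=
    ((Module.finBasisOfFinrankEq S _ hrank).equivFun).symm
  let φ₀ : (Fin n → S) →ₗ[S] (Fin n → S) := (LinearMap.ker p).subtype ∘ₗ e.toLinearMap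
  -- The other half of the matrix factorization: `ψ₀` is `f` times the inverse of `φ₀`.
  let ψ₀ : (Fin n → S) →ₗ[S] (Fin n → S) := e.symm.toLinearMap ∘ₗ μ
  have hφψ (g) : φ₀ (ψ₀ g) = f • g := by
    change ((e (e.symm (μ g)) : LinearMap.ker p) : Fin n → S) = f • g
    rw [e.apply_symm_apply]
    rfl
  have hφinj : Function.Injective φ₀ := Subtype.val_injective.comp e.injective
  have hφrange (g) : p g = 0 ↔ ∃ h, g = φ₀ h := by
    refine ⟨fun hg => ⟨e.symm ⟨g, hg⟩, by simp [φ₀]⟩, ?_⟩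
    rintro ⟨h, rfl⟩
    exact (e h).2
  let ext (θ : (Fin n → S) →ₗ[S] (Fin n → S)) : (Fin n → B) →ₗ[B] (Fin n → B) :=
    ((LinearMap.toMatrix' θ).map (algebraMap S B)).mulVecLin
  have hext (θ g) : ext θ (σ g) = σ (θ g) := by
    funext i
    change (((LinearMap.toMatrix' θ).map (algebraMap S B)).mulVec (algebraMap S B ∘ g)) i =
      algebraMap S B (θ g i)
    rw [← RingHom.map_mulVec, LinearMap.toMatrix'_mulVec]
  have hkerψ : LinearMap.ker (ext ψ₀) = LinearMap.ker π := by
    ext x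
    obtain ⟨g, rfl⟩ := hσ x
    rw [LinearMap.mem_ker, LinearMap.mem_ker, hext, hσ0]
    refine Iff.trans ?_ (hφrange g).symm
    refine exists_congr fun h => ?_
    rw [← hφinj.eq_iff, hφψ, map_smul]
    exact ⟨hfinj, fun h => by rw [h]⟩
  have hrangeψ : LinearMap.range (ext ψ₀) = LinearMap.ker (ext φ₀) := by
    ext x
    obtain ⟨g, rfl⟩ := hσ x
    rw [LinearMap.mem_ker, hext, hσ0, LinearMap.mem_range]
    constructor
    · rintro ⟨z, hz⟩
      obtain ⟨h, rfl⟩ := hσ z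
      rw [hext, ← sub_eq_zero, ← map_sub, hσ0] at hz
      obtain ⟨w, hw⟩ := hz
      refine ⟨h - φ₀ w, ?_⟩
      have hg : g = ψ₀ h - f • w := by rw [← hw]; abel
      rw [hg, map_sub, hφψ, map_smul, smul_sub]
    · rintro ⟨h, hh⟩
      refine ⟨σ h, ?_⟩
      rw [hext]
      congr 1
      apply hφinj
      rw [hφψ, hh]
  refine ⟨ext φ₀, ?_, ⟨?_⟩⟩
  · ext x
    obtain ⟨g, rfl⟩ := hσ x
    rw [LinearMap.mem_ker, LinearMap.mem_range]
    refine Iff.trans ?_ (hφrange g).symm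
    constructor
    · rintro ⟨z, hz⟩
      obtain ⟨h, rfl⟩ := hσ z
      rw [hext] at hz
      rw [← hφrange]
      change π (σ g) = 0
      rw [← hz]
      exact (hφrange _).mpr ⟨h, rfl⟩
    · rintro ⟨h, rfl⟩
      exact ⟨σ h, hext _ _⟩
  · exact (LinearEquiv.ofEq _ _ hrangeψ.symm).trans ((ext ψ₀).quotKerEquivRange.symm.trans
      ((Submodule.quotEquivOfEq _ _ hkerψ).trans (π.quotKerEquivOfSurjective hπ)))

/-- This says that `S ⧸ (f)` has zero socle. From `u z = f a` and `v z = f b` follows `v a = u b`,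
so `u` divides `a` and cancels. -/
theorem IsRegularLocalRing.mem_span_of_forall_mul_mem (hS : ringKrullDim S = 2) {f z : S}
    (hf : f ≠ 0) (h : ∀ x ∈ maximalIdeal S, x * z ∈ Ideal.span {f}) : z ∈ Ideal.span {f} := by
  obtain ⟨u, v, huv, hu, hv, _⟩ := IsRegularLocalRing.exists_prime_span_pair hS
  obtain ⟨a, ha⟩ := Ideal.mem_span_singleton.mp (h u (huv ▸ Ideal.subset_span (by simp)))
  obtain ⟨b, hb⟩ := Ideal.mem_span_singleton.mp (h v (huv ▸ Ideal.subset_span (by simp)))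
  have hab : v * a = u * b := by
    refine mul_left_cancel₀ hf ?_
    linear_combination u * hb - v * ha
  obtain ⟨c, rfl⟩ := (hu.dvd_or_dvd ⟨b, hab⟩).resolve_left hv
  refine Ideal.mem_span_singleton.mpr ⟨c, mul_left_cancel₀ hu.ne_zero ?_⟩
  rw [ha]; ring

end RegularDimTwo

/-! ### Descent of periodicity along a flat local map with trivial residue extension -/

section Descent

open IsLocalRing TensorProduct

/-- Schanuel's lemma. -/
theorem nonempty_ker_prod_equiv_of_range_eq {R P P' Q : Type*} [CommRing R] [AddCommGroup P]
    [Module R P] [AddCommGroup P'] [Module R P'] [AddCommGroup Q] [Module R Q]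
    [Module.Projective R P] [Module.Projective R P'] (f : P →ₗ[R] Q) (g : P' →ₗ[R] Q)
    (h : LinearMap.range f = LinearMap.range g) :
    Nonempty ((LinearMap.ker f × P') ≃ₗ[R] (LinearMap.ker g × P)) := by
  obtain ⟨b, hb⟩ := Module.projective_lifting_property g.rangeRestrict
    (f.codRestrict (LinearMap.range g) fun x => h ▸ LinearMap.mem_range_self f x)
    g.surjective_rangeRestrict
  obtain ⟨a, ha⟩ := Module.projective_lifting_property f.rangeRestrict
    (g.codRestrict (LinearMap.range f) fun x => h ▸ LinearMap.mem_range_self g x)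
    f.surjective_rangeRestrict
  have ha' (y : P') : f (a y) = g y := congrArg Subtype.val (LinearMap.congr_fun ha y)
  have hb' (x : P) : g (b x) = f x := congrArg Subtype.val (LinearMap.congr_fun hb x)
  -- Both products are the fibre product of `P` and `P'` over `Q`, parametrized by means of the
  -- lifts `a` and `b`.
  refine ⟨
    { toFun := fun z => (⟨z.2 - b (z.1 + a z.2), by simp [ha', hb']⟩, z.1 + a z.2)
      invFun := fun z => (⟨z.2 - a (z.1 + b z.2), by simp [ha', hb']⟩, z.1 + b z.2)
      map_add' := ?_
      map_smul' := ?_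
      left_inv := ?_
      right_inv := ?_ }⟩
  · rintro ⟨⟨k, hk⟩, y⟩ ⟨⟨k', hk'⟩, y'⟩
    refine Prod.ext (Subtype.ext ?_) ?_
    · simp only [Prod.mk_add_mk, AddMemClass.mk_add_mk, map_add]; abel
    · simp only [Prod.mk_add_mk, AddMemClass.mk_add_mk, map_add]; abel
  · rintro r ⟨⟨k, hk⟩, y⟩
    refine Prod.ext (Subtype.ext ?_) ?_ <;> simp [smul_sub, smul_add]
  · rintro ⟨⟨k, hk⟩, y⟩
    refine Prod.ext (Subtype.ext ?_) ?_ <;> simp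
  · rintro ⟨⟨k, hk⟩, y⟩
    refine Prod.ext (Subtype.ext ?_) ?_ <;> simp

variable {A B : Type*} [CommRing A] [IsLocalRing A] [IsNoetherianRing A] [CommRing B]
  [IsLocalRing B] [Algebra A B] [Module.Flat A B] [IsLocalHom (algebraMap A B)]
  {M N : Type*} [AddCommGroup M] [Module A M] [Module.Finite A M] [AddCommGroup N] [Module A N]
  [Module.Finite A N]

/-- Maps after base change are `B`-combinations of maps over `A`. Replacing each coefficient by an
element of `A` with the same residue changes `h` only modulo the maximal ideal, so surjectivity
survives by Nakayama and descends by faithful flatness. -/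
theorem exists_surjective_of_baseChange
    (hres : ∀ b : B, ∃ a : A, b - algebraMap A B a ∈ maximalIdeal B)
    (h : B ⊗[A] M →ₗ[B] B ⊗[A] N) (hh : Function.Surjective h) :
    ∃ g : M →ₗ[A] N, Function.Surjective g := by
  have : Module.FinitePresentation A M := Module.finitePresentation_of_finite A M
  have key (h : B ⊗[A] M →ₗ[B] B ⊗[A] N) : ∃ g : M →ₗ[A] N, ∀ x,
      h x - g.baseChange B x ∈ maximalIdeal B • (⊤ : Submodule B (B ⊗[A] N)) := by
    refine (Module.FinitePresentation.isBaseChange_map A M N B).inductionOn h _ ?_ ?_ ?_ ?_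
    · exact ⟨0, fun x => by simp⟩
    · exact fun g => ⟨g, fun x => by simp⟩
    · rintro b h ⟨g, hg⟩
      obtain ⟨a, ha⟩ := hres b
      refine ⟨a • g, fun x => ?_⟩
      have : (b • h) x - (a • g).baseChange B x =
          (b - algebraMap A B a) • h x + algebraMap A B a • (h x - g.baseChange B x) := by
        have aux {X : Type _} [AddCommGroup X] [Module B X] (b c : B) (z w : X) :
            b • z - c • w = (b - c) • z + c • (z - w) := by
          rw [sub_smul, smul_sub]; abel
        rw [LinearMap.baseChange_smul, LinearMap.smul_apply, LinearMap.smul_apply,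
          ← algebraMap_smul B a]
        exact aux _ _ _ _
      rw [this]
      exact add_mem (Submodule.smul_mem_smul ha trivial) (Submodule.smul_mem _ _ (hg x))
    · rintro h₁ h₂ ⟨g₁, hg₁⟩ ⟨g₂, hg₂⟩
      refine ⟨g₁ + g₂, fun x => ?_⟩
      have : (h₁ + h₂) x - (g₁ + g₂).baseChange B x =
          (h₁ x - g₁.baseChange B x) + (h₂ x - g₂.baseChange B x) := by
        rw [LinearMap.baseChange_add, LinearMap.add_apply, LinearMap.add_apply]
        abel
      rw [this]
      exact add_mem (hg₁ x) (hg₂ x)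
  obtain ⟨g, hg⟩ := key h
  refine ⟨g, ?_⟩
  have : Module.FaithfullyFlat A B := Module.FaithfullyFlat.of_flat_of_isLocalHom
  rw [← Module.FaithfullyFlat.lTensor_surjective_iff_surjective A B]
  change Function.Surjective (g.baseChange B)
  rw [← LinearMap.range_eq_top, ← top_le_iff]
  refine Submodule.le_of_le_smul_of_le_jacobson_bot (I := maximalIdeal B) Module.Finite.fg_top
    (maximalIdeal_le_jacobson _) fun y _ => ?_
  obtain ⟨x, rfl⟩ := hh y
  have := add_mem (Submodule.mem_sup_left (LinearMap.mem_range_self (g.baseChange B) x))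
    (Submodule.mem_sup_right (hg x) : _ ∈ LinearMap.range (g.baseChange B) ⊔ _)
  simpa using this

/-- Surjections exist both ways, and a surjective endomorphism of a finite module is injective. -/
theorem nonempty_equiv_of_baseChange
    (hres : ∀ b : B, ∃ a : A, b - algebraMap A B a ∈ maximalIdeal B)
    (e : (B ⊗[A] M) ≃ₗ[B] B ⊗[A] N) : Nonempty (M ≃ₗ[A] N) := by
  obtain ⟨g, hg⟩ := exists_surjective_of_baseChange hres e.toLinearMap e.surjective
  obtain ⟨g', hg'⟩ := exists_surjective_of_baseChange hres e.symm.toLinearMap e.symm.surjective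
  have hinj := OrzechProperty.injective_of_surjective_endomorphism (g' ∘ₗ g) (hg'.comp hg)
  exact ⟨LinearEquiv.ofBijective g ⟨Function.Injective.of_comp hinj, hg⟩⟩

variable {S : Type u} [CommRing S] [IsRegularLocalRing S] [Algebra S B]

/-- Modules of positive depth over a one-dimensional hypersurface have, up to free summands,
periodic resolutions of period two. -/
theorem exists_periodic_of_baseChange (hS : ringKrullDim S = 2) {f : S} (hf : f ≠ 0)
    (hsurj : Function.Surjective (algebraMap S B))
    (hker : RingHom.ker (algebraMap S B) = Ideal.span {f})
    (hres : ∀ b : B, ∃ a : A, b - algebraMap A B a ∈ maximalIdeal B)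
    {x : A} (hx : x ∈ maximalIdeal A) (hreg : IsSMulRegular M x) {n : ℕ}
    (π : (Fin n → A) →ₗ[A] M) (hπ : Function.Surjective π) :
    ∃ ρ : (Fin n → A) →ₗ[A] (Fin n → A), LinearMap.range ρ = LinearMap.ker π ∧
      Nonempty ((LinearMap.ker ρ × (Fin n → A)) ≃ₗ[A] (M × (Fin n → A))) := by
  let E : (B ⊗[A] (Fin n → A)) ≃ₗ[B] (Fin n → B) := TensorProduct.piScalarRight A B B (Fin n)
  let πB : (Fin n → B) →ₗ[B] B ⊗[A] M := π.baseChange B ∘ₗ E.symm.toLinearMap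
  have hπB : Function.Surjective πB := (LinearMap.lTensor_surjective B hπ).comp E.symm.surjective
  obtain ⟨y, hy⟩ := hsurj (algebraMap A B x)
  have hxB : algebraMap A B x ∈ maximalIdeal B := by
    rw [mem_maximalIdeal, mem_nonunits_iff, isUnit_map_iff]
    exact hx
  have hym : y ∈ maximalIdeal S := by
    rw [mem_maximalIdeal, mem_nonunits_iff]
    exact fun h => hxB (hy ▸ h.map (algebraMap S B))
  have hregB : IsSMulRegular (B ⊗[A] M) (algebraMap A B x) :=
    hreg.of_flat_of_isBaseChange (TensorProduct.isBaseChange A M B)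
  have hregS : IsSMulRegular (B ⊗[A] M) y := by
    intro z w hzw
    refine hregB ?_
    change algebraMap A B x • z = algebraMap A B x • w
    rw [← hy, algebraMap_smul, algebraMap_smul]
    exact hzw
  obtain ⟨φ, hφ, ⟨eφ⟩⟩ := IsRegularLocalRing.exists_matrixFactorization hS hf hsurj hker πB hπB
    hym hregS
  -- the kernel of `π` is generated by `n` elements
  let eΩ := LinearMap.tensorKerEquiv B B π
  have hrange (z : B ⊗[A] (Fin n → A)) :
      z ∈ LinearMap.ker (AlgebraTensorModule.lTensor B B π) ↔ E z ∈ LinearMap.range φ := by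
    rw [hφ, LinearMap.mem_ker, LinearMap.mem_ker]
    change _ ↔ π.baseChange B (E.symm (E z)) = 0
    rw [E.symm_apply_apply]
    rfl
  let s : B ⊗[A] (Fin n → A) →ₗ[B] LinearMap.ker (AlgebraTensorModule.lTensor B B π) :=
    (E.symm.toLinearMap ∘ₗ φ ∘ₗ E.toLinearMap).codRestrict _ fun z => by
      rw [hrange]; simp
  have hs : Function.Surjective s := by
    rintro ⟨z, hz⟩
    obtain ⟨w, hw⟩ := (hrange z).mp hz
    refine ⟨E.symm w, Subtype.ext ?_⟩
    change E.symm (φ (E (E.symm w))) = z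
    rw [E.apply_symm_apply, hw, E.symm_apply_apply]
  obtain ⟨ρ₀, hρ₀⟩ := exists_surjective_of_baseChange hres (eΩ.symm.toLinearMap ∘ₗ s)
    (eΩ.symm.surjective.comp hs)
  let ρ := (LinearMap.ker π).subtype ∘ₗ ρ₀
  have hρ : LinearMap.range ρ = LinearMap.ker π := by
    rw [LinearMap.range_comp, LinearMap.range_eq_top.mpr hρ₀, Submodule.map_top,
      Submodule.range_subtype]
  refine ⟨ρ, hρ, ?_⟩
  have hexact : Function.Exact ρ π := by
    rw [LinearMap.exact_iff, hρ]
  have hexactB : Function.Exact (ρ.baseChange B) (π.baseChange B) := lTensor_exact B hexact hπ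
  let g : (B ⊗[A] (Fin n → A)) →ₗ[B] (Fin n → B) := E.toLinearMap ∘ₗ ρ.baseChange B
  have hrange' : LinearMap.range φ = LinearMap.range g := by
    ext w
    rw [hφ, LinearMap.mem_ker]
    change π.baseChange B (E.symm w) = 0 ↔ _
    rw [hexactB (E.symm w)]
    refine exists_congr fun z => ?_
    rw [LinearEquiv.eq_symm_apply]
    rfl
  -- The descended map need not be `φ` after base change; it only has the same image. Schanuel's
  -- lemma compares the kernels, at the price of a free summand.
  obtain ⟨eS⟩ := nonempty_ker_prod_equiv_of_range_eq φ g hrange'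
  have hkerg : LinearMap.ker g = LinearMap.ker (AlgebraTensorModule.lTensor B B ρ) := by
    rw [LinearEquiv.ker_comp]; rfl
  let eL := LinearMap.tensorKerEquiv B B ρ
  refine nonempty_equiv_of_baseChange (B := B) hres ?_
  let e₁ : ((B ⊗[A] LinearMap.ker ρ) × (B ⊗[A] (Fin n → A))) ≃ₗ[B]
      (LinearMap.ker g × (Fin n → B)) :=
    LinearEquiv.prodCongr (eL.trans (LinearEquiv.ofEq _ _ hkerg.symm)) E
  let e₂ : (LinearMap.ker φ × (B ⊗[A] (Fin n → A))) ≃ₗ[B]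
      ((B ⊗[A] M) × (B ⊗[A] (Fin n → A))) :=
    LinearEquiv.prodCongr eφ (LinearEquiv.refl B _)
  exact (TensorProduct.prodRight A B B _ _).trans ((e₁.trans (eS.symm.trans e₂)).trans
    (TensorProduct.prodRight A B B _ _).symm)

/-- Going down holds for flat maps, and the closed fibre is a field. -/
theorem ringKrullDim_eq_of_flat_of_map_maximalIdeal [IsNoetherianRing B]
    (hmap : (maximalIdeal A).map (algebraMap A B) = maximalIdeal B) :
    ringKrullDim B = ringKrullDim A := by
  have : (maximalIdeal B).LiesOver (maximalIdeal A) :=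
    ⟨(maximalIdeal_comap (algebraMap A B)).symm⟩
  have h := Ideal.height_eq_height_add_of_liesOver_of_hasGoingDown (maximalIdeal A) (maximalIdeal B)
  rw [hmap, Ideal.map_quotient_self] at h
  rw [← maximalIdeal_height_eq_ringKrullDim, ← maximalIdeal_height_eq_ringKrullDim, h,
    Ideal.height_bot, add_zero]

end Descent

/-! ### One-dimensional hypersurfaces -/

section Hypersurface

open IsLocalRing

theorem IsRegularLocalRing.ringKrullDim_eq_two_of_quotient {S : Type*} [CommRing S]
    [IsRegularLocalRing S] {f : S} (hf : f ≠ 0) (hfm : f ∈ maximalIdeal S)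
    (hdim : ringKrullDim (S ⧸ Ideal.span {f}) = 1) : ringKrullDim S = 2 := by
  have hd := IsRegularLocalRing.spanFinrank_maximalIdeal (R := S)
  have hle : ringKrullDim S ≤ 2 := by
    have := Ideal.height_le_ringKrullDim_quotient_add_one hfm
    rw [maximalIdeal_height_eq_ringKrullDim, hdim] at this
    exact this.trans_eq one_add_one_eq_two
  generalize hn : (maximalIdeal S).spanFinrank = n at hd
  obtain ⟨F, hF, hspan⟩ := Submodule.FG.exists_span_finset_card_eq_spanFinrank
    (maximalIdeal S).fg_of_isNoetherianRing
  rw [hn] at hF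
  have hn2 : n ≤ 2 := by
    rw [← hd] at hle
    exact_mod_cast hle
  interval_cases n
  · obtain rfl := Finset.card_eq_zero.mp hF
    rw [Finset.coe_empty, Submodule.span_empty] at hspan
    rw [← hspan] at hfm
    exact absurd hfm hf
  · obtain ⟨v, rfl⟩ := Finset.card_eq_one.mp hF
    rw [Finset.coe_singleton] at hspan
    have hv : ¬ IsNilpotent v := by
      intro hv
      have : (maximalIdeal S).height = 0 := by
        rw [Ideal.height_eq_zero_iff]
        refine ⟨⟨inferInstance, bot_le⟩, fun q hq _ => ?_⟩
        have := hq.1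
        rw [← hspan, Submodule.span_singleton_le_iff_mem]
        obtain ⟨k, hk⟩ := hv
        exact hq.1.mem_of_pow_mem k (hk ▸ zero_mem q)
      rw [← maximalIdeal_height_eq_ringKrullDim, this] at hd
      norm_num at hd
    have := isDomain_of_maximalIdeal_eq_span_singleton hspan.symm hv
    have h := ringKrullDim_quotient_succ_le_of_nonZeroDivisor (mem_nonZeroDivisors_of_ne_zero hf)
    rw [hdim, ← hd] at h
    norm_num at h
  · exact hd.symm

/-- Structure of a one-dimensional hypersurface: it has positive depth, and its modules of positive
depth have periodic resolutions of period two up to free summands. -/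
theorem IsLocalHypersurface.exists_periodic {A : Type u} [CommRing A] [IsLocalRing A]
    (hA : IsLocalHypersurface A) (hdim : ringKrullDim A = 1) :
    (∃ x ∈ maximalIdeal A, IsSMulRegular A x) ∧
    ∀ (M : Type u) [AddCommGroup M] [Module A M] [Module.Finite A M] (x : A)
      (_ : x ∈ maximalIdeal A) (_ : IsSMulRegular M x) (n : ℕ) (π : (Fin n → A) →ₗ[A] M)
      (_ : Function.Surjective π),
      ∃ ρ : (Fin n → A) →ₗ[A] (Fin n → A), LinearMap.range ρ = LinearMap.ker π ∧
        Nonempty ((LinearMap.ker ρ × (Fin n → A)) ≃ₗ[A] (M × (Fin n → A))) := by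
  obtain ⟨_, S, _, _, f, hf, hfm, ⟨e⟩⟩ := hA
  let C := AdicCompletion (maximalIdeal A) A
  let B := S ⧸ Ideal.span {f}
  let _ : Algebra A B := (e.toRingHom.comp (algebraMap A C)).toAlgebra
  let eA : C ≃ₐ[A] B := AlgEquiv.ofRingEquiv (f := e) fun _ => rfl
  have : IsLocalRing B := e.isLocalRing
  have : Module.Flat A B := Module.Flat.of_linearEquiv eA.symm.toLinearEquiv
  have hmax (c : C) : e c ∈ maximalIdeal B ↔ c ∈ maximalIdeal C := by
    rw [mem_maximalIdeal, mem_maximalIdeal, mem_nonunits_iff, mem_nonunits_iff,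
      MulEquiv.isUnit_map]
  have hloc : IsLocalHom (algebraMap A B) := by
    refine ⟨fun a ha => ?_⟩
    have h : IsUnit (algebraMap A C a) := (MulEquiv.isUnit_map e).mp ha
    exact (isUnit_map_iff (algebraMap A C) a).mp h
  have hmap : (maximalIdeal A).map (algebraMap A B) = maximalIdeal B := by
    rw [← map_ringEquiv_maximalIdeal e, AdicCompletion.maximalIdeal_eq_map]
    exact (Ideal.map_map (algebraMap A C) e.toRingHom).symm
  have hres (b : B) : ∃ a : A, b - algebraMap A B a ∈ maximalIdeal B := by
    obtain ⟨c, rfl⟩ := e.surjective b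
    obtain ⟨r, hr⟩ := (AdicCompletion.residueField_map_bijective A).2 (residue C c)
    obtain ⟨a, rfl⟩ := residue_surjective r
    refine ⟨a, ?_⟩
    have : c - algebraMap A C a ∈ maximalIdeal C := by
      rw [ResidueField.map_residue] at hr
      exact Ideal.Quotient.eq.mp hr.symm
    rw [← hmax, map_sub] at this
    exact this
  have hS : ringKrullDim S = 2 :=
    IsRegularLocalRing.ringKrullDim_eq_two_of_quotient hf hfm
      ((ringKrullDim_eq_of_flat_of_map_maximalIdeal hmap).trans hdim)
  have : Module.FaithfullyFlat A B := Module.FaithfullyFlat.of_flat_of_isLocalHom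
  refine ⟨?_, fun M _ _ _ x hx hreg n π hπ => exists_periodic_of_baseChange (B := B) hS hf
    Ideal.Quotient.mk_surjective Ideal.mk_ker hres hx hreg π hπ⟩
  -- If every element of the maximal ideal is a zero divisor, some `z ≠ 0` is killed by that ideal.
  -- Its image in `B` lies in the socle, which is zero, although `A → B` is injective.
  by_contra! h
  have hdisj : Disjoint (maximalIdeal A : Set A) (nonZeroDivisors A) := by
    rw [Set.disjoint_left]
    intro x hx hx'
    exact h x hx (Module.Flat.isSMulRegular_of_nonZeroDivisors hx')
  obtain ⟨-, z, hz, hz0⟩ := SetLike.lt_iff_le_and_exists.mp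
    (Ideal.bot_lt_annihilator_of_disjoint_nonZeroDivisors hdisj)
  obtain ⟨s, hs⟩ := Ideal.Quotient.mk_surjective (algebraMap A B z)
  have hann : maximalIdeal B ≤ LinearMap.ker (LinearMap.toSpanSingleton B B (algebraMap A B z)) := by
    rw [← hmap, Ideal.map_le_iff_le_comap]
    intro x hx
    have hzx : z * x = 0 := congrArg Subtype.val (Module.mem_annihilator.mp hz ⟨x, hx⟩)
    rw [Ideal.mem_comap, LinearMap.mem_ker, LinearMap.toSpanSingleton_apply, smul_eq_mul,
      ← map_mul, mul_comm, hzx, map_zero]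
  have hsf : s ∈ Ideal.span {f} := by
    refine IsRegularLocalRing.mem_span_of_forall_mul_mem hS hf fun t ht => ?_
    rw [← Ideal.Quotient.eq_zero_iff_mem, map_mul, hs]
    refine hann ?_
    rw [mem_maximalIdeal, mem_nonunits_iff]
    intro hunit
    obtain ⟨w, hw⟩ := hunit.exists_right_inv
    obtain ⟨w, rfl⟩ := Ideal.Quotient.mk_surjective w
    have h1 : t * w - 1 ∈ Ideal.span {f} := Ideal.Quotient.eq.mp (by simpa using hw)
    have h2 := (Ideal.span_le.mpr (by simpa using hfm) : Ideal.span {f} ≤ maximalIdeal S) h1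
    exact (maximalIdeal.isMaximal S).ne_top ((Ideal.eq_top_iff_one _).mpr
      (by simpa using sub_mem (Ideal.mul_mem_right w _ ht) h2))
  rw [← Ideal.Quotient.eq_zero_iff_mem, hs] at hsf
  exact hz0 (FaithfulSMul.algebraMap_injective A B (hsf.trans (map_zero _).symm))

end Hypersurface

/-! ### Exact pairs at the minimal primes, periodicity and finite length -/

section DimensionOne

open IsLocalRing

variable {A : Type u} [CommRing A]

/-- If the annihilator of `a` is `(b)`, then `A ⧸ (b)` is the first syzygy of `A ⧸ (a)`. -/
theorem exists_syzygy_quotient_span_singleton {a b : A}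
    (hab : ∀ y, a * y = 0 ↔ y ∈ Ideal.span {b}) :
    ∃ k : (A ⧸ Ideal.span {b}) →ₗ[A] A, Function.Injective k ∧
      Function.Exact k (Ideal.span {a}).mkQ ∧ ∀ y, k (Ideal.Quotient.mk _ y) = y * a := by
  let k : (A ⧸ Ideal.span {b}) →ₗ[A] A := (Ideal.span {b}).liftQ (LinearMap.toSpanSingleton A A a)
    fun y hy => by
      rw [LinearMap.mem_ker, LinearMap.toSpanSingleton_apply, smul_eq_mul, mul_comm]
      exact (hab y).mpr hy
  have hk (y : A) : k (Ideal.Quotient.mk _ y) = y * a := rfl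
  refine ⟨k, ?_, ?_, hk⟩
  · refine (injective_iff_map_eq_zero _).mpr fun y hy => ?_
    obtain ⟨y, rfl⟩ := Ideal.Quotient.mk_surjective y
    rw [hk, mul_comm, hab] at hy
    exact Ideal.Quotient.eq_zero_iff_mem.mpr hy
  · intro y
    rw [Submodule.mkQ_apply, Submodule.Quotient.mk_eq_zero, Ideal.mem_span_singleton']
    refine ⟨fun ⟨c, hc⟩ => ⟨Ideal.Quotient.mk _ c, hc⟩, fun ⟨c, hc⟩ => ?_⟩
    obtain ⟨c, rfl⟩ := Ideal.Quotient.mk_surjective c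
    exact ⟨c, hc⟩

theorem nonempty_tor_quotient_span_singleton_equiv {a b : A}
    (hab : ∀ y, a * y = 0 ↔ y ∈ Ideal.span {b}) (i : ℕ) (N : Type u) [AddCommGroup N]
    [Module A N] : Nonempty (torModule A (i + 2) (A ⧸ Ideal.span {a}) N ≃ₗ[A]
      torModule A (i + 1) (A ⧸ Ideal.span {b}) N) := by
  obtain ⟨k, hk, hex, -⟩ := exists_syzygy_quotient_span_singleton hab
  exact nonempty_tor_succ_equiv hk hex (Submodule.mkQ_surjective _) i N

/-- These modules are also higher `Tor` modules of `A ⧸ (b)`, so both `a` and `b` kill them. -/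
theorem smul_tor_eq_zero_of_mem_sup {a b : A} (hab : ∀ y, b * y = 0 ↔ y ∈ Ideal.span {a})
    (i : ℕ) (N : Type u) [AddCommGroup N] [Module A N] {r : A}
    (hr : r ∈ Ideal.span {a} ⊔ Ideal.span {b})
    (x : torModule A (i + 1) (A ⧸ Ideal.span {a}) N) : r • x = 0 := by
  obtain ⟨c, hc, d, hd, rfl⟩ := Submodule.mem_sup.mp hr
  rw [add_smul, smul_tor_quotient_eq_zero _ i N hc, zero_add]
  obtain ⟨e⟩ := nonempty_tor_quotient_span_singleton_equiv hab i N
  apply e.symm.injective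
  rw [map_smul, smul_tor_quotient_eq_zero _ (i + 1) N hd, map_zero]

theorem nonempty_tor_prod_equiv (L F N : Type u) [AddCommGroup L] [Module A L] [AddCommGroup F]
    [Module A F] [Module.Flat A F] [AddCommGroup N] [Module A N] (i : ℕ) :
    Nonempty (torModule A (i + 1) L N ≃ₗ[A] torModule A (i + 1) (L × F) N) := by
  obtain ⟨α, β, δ, h⟩ := exists_tor_longExact (LinearMap.inl A L F) (LinearMap.snd A L F)
    LinearMap.inl_injective .inl_snd LinearMap.snd_surjective N
  have := subsingleton_tor_of_flat (A := A) (F := F) i N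
  have := subsingleton_tor_of_flat (A := A) (F := F) (i + 1) N
  refine ⟨LinearEquiv.ofBijective (α (i + 1)) ⟨?_, fun y => ?_⟩⟩
  · refine (injective_iff_map_eq_zero _).mpr fun x hx => ?_
    obtain ⟨y, rfl⟩ := ((h (i + 1)).2.2 x).mp hx
    rw [Subsingleton.elim y 0, map_zero]
  · exact ((h (i + 1)).1 y).mp (Subsingleton.elim _ _)

/-- Up to free summands, every finitely generated module of positive depth is its own second
syzygy, in a resolution by free modules of constant rank. -/
def HasPeriodicResolutions (A : Type u) [CommRing A] [IsLocalRing A] : Prop :=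
  ∀ (M : Type u) [AddCommGroup M] [Module A M] [Module.Finite A M] (x : A)
    (_ : x ∈ maximalIdeal A) (_ : IsSMulRegular M x) (n : ℕ) (π : (Fin n → A) →ₗ[A] M)
    (_ : Function.Surjective π),
    ∃ ρ : (Fin n → A) →ₗ[A] (Fin n → A), LinearMap.range ρ = LinearMap.ker π ∧
      Nonempty ((LinearMap.ker ρ × (Fin n → A)) ≃ₗ[A] (M × (Fin n → A)))

variable [IsLocalRing A]

theorem HasPeriodicResolutions.nonempty_tor_equiv (hper : HasPeriodicResolutions A) {M : Type u}
    [AddCommGroup M] [Module A M] [Module.Finite A M] {x : A} (hx : x ∈ maximalIdeal A)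
    (hreg : IsSMulRegular M x) (i : ℕ) (N : Type u) [AddCommGroup N] [Module A N] :
    Nonempty (torModule A (i + 3) M N ≃ₗ[A] torModule A (i + 1) M N) := by
  obtain ⟨n, π, hπ⟩ := Module.Finite.exists_fin' A M
  obtain ⟨ρ, hρ, ⟨e⟩⟩ := hper M x hx hreg n π hπ
  have hex : Function.Exact (LinearMap.range ρ).subtype π := by
    rw [LinearMap.exact_iff, Submodule.range_subtype, hρ]
  obtain ⟨e₁⟩ := nonempty_tor_succ_equiv Subtype.val_injective hex hπ (i + 1) N
  have hex' : Function.Exact (LinearMap.ker ρ).subtype ρ.rangeRestrict := by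
    rw [LinearMap.exact_iff, Submodule.range_subtype, LinearMap.ker_rangeRestrict]
  obtain ⟨e₂⟩ := nonempty_tor_succ_equiv Subtype.val_injective hex' ρ.surjective_rangeRestrict i N
  obtain ⟨e₃⟩ := nonempty_tor_prod_equiv (A := A) (LinearMap.ker ρ) (Fin n → A) N i
  obtain ⟨e₄⟩ := nonempty_tor_equiv_of_equiv e (i + 1) N
  obtain ⟨e₅⟩ := nonempty_tor_prod_equiv (A := A) M (Fin n → A) N i
  exact ⟨e₁.trans (e₂.trans (e₃.trans (e₄.trans e₅.symm)))⟩

/-- For arbitrary `M`, pass to the first syzygy: as a submodule of a free module it has positive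
depth. This costs one degree. -/
theorem HasPeriodicResolutions.nonempty_tor_equiv' [IsNoetherianRing A]
    (hper : HasPeriodicResolutions A) {x : A} (hx : x ∈ maximalIdeal A) (hreg : IsSMulRegular A x)
    (M : Type u) [AddCommGroup M] [Module A M] [Module.Finite A M] (i : ℕ) (N : Type u)
    [AddCommGroup N] [Module A N] :
    Nonempty (torModule A (i + 4) M N ≃ₗ[A] torModule A (i + 2) M N) := by
  obtain ⟨n, π, hπ⟩ := Module.Finite.exists_fin' A M
  have hreg' : IsSMulRegular (LinearMap.ker π) x := fun y z h =>
    Subtype.ext (funext fun j => hreg (congrFun (congrArg Subtype.val h) j))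
  obtain ⟨e₁⟩ := nonempty_tor_succ_equiv Subtype.val_injective (LinearMap.exact_subtype_ker_map π)
    hπ (i + 2) N
  obtain ⟨e₂⟩ := hper.nonempty_tor_equiv (M := LinearMap.ker π) hx hreg' i N
  obtain ⟨e₃⟩ := nonempty_tor_succ_equiv Subtype.val_injective (LinearMap.exact_subtype_ker_map π)
    hπ i N
  exact ⟨e₁.trans (e₂.trans e₃.symm)⟩

/-- For the cover of `A ⧸ I` by a free module of rank one, the map `ρ` is a 1 × 1 matrix, and its
entry generates `I`. -/
theorem HasPeriodicResolutions.exists_eq_span_singleton (hper : HasPeriodicResolutions A)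
    {x : A} (hx : x ∈ maximalIdeal A) (I : Ideal A) (hreg : IsSMulRegular (A ⧸ I) x) :
    ∃ a, I = Ideal.span {a} := by
  let π : (Fin 1 → A) →ₗ[A] A ⧸ I := I.mkQ ∘ₗ LinearMap.proj 0
  have hπ : Function.Surjective π := fun y => by
    obtain ⟨y, rfl⟩ := I.mkQ_surjective y
    exact ⟨fun _ => y, rfl⟩
  obtain ⟨ρ, hρ, -⟩ := hper (A ⧸ I) x hx hreg 1 π hπ
  have hmul (c : Fin 1 → A) : ρ c 0 = c 0 * ρ 1 0 := by
    have : c = c 0 • (1 : Fin 1 → A) := by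
      ext j; obtain rfl := Subsingleton.elim j 0; simp
    conv_lhs => rw [this, map_smul]
    simp
  refine ⟨ρ 1 0, le_antisymm (fun y hy => ?_) ?_⟩
  · have h : (fun _ => y : Fin 1 → A) ∈ LinearMap.ker π := by
      rw [LinearMap.mem_ker]
      exact (Submodule.Quotient.mk_eq_zero _).mpr hy
    rw [← hρ] at h
    obtain ⟨c, hc⟩ := h
    exact Ideal.mem_span_singleton'.mpr ⟨c 0, by rw [← hmul, hc]⟩
  · rw [Ideal.span_singleton_le_iff_mem]
    have h : ρ 1 ∈ LinearMap.ker π := hρ ▸ LinearMap.mem_range_self ρ 1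
    exact (Submodule.Quotient.mk_eq_zero _).mp h

theorem maximalIdeal_notMem_minimalPrimes (hdim : ringKrullDim A = 1) :
    maximalIdeal A ∉ minimalPrimes A := by
  intro h
  rw [← Ideal.height_eq_zero_iff] at h
  have := maximalIdeal_height_eq_ringKrullDim (R := A)
  rw [h, hdim] at this
  norm_num at this

theorem mem_minimalPrimes_of_ne_maximalIdeal (hdim : ringKrullDim A = 1) (p : Ideal A) [p.IsPrime]
    (hp : p ≠ maximalIdeal A) : p ∈ minimalPrimes A := by
  have hlt : p < maximalIdeal A := lt_of_le_of_ne (le_maximalIdeal Ideal.IsPrime.ne_top') hp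
  have h1 := Ideal.height_add_one_le_of_lt_of_isPrime hlt
  have h2 : (maximalIdeal A).height = 1 := by
    have := maximalIdeal_height_eq_ringKrullDim (R := A)
    rw [hdim] at this
    exact WithBot.coe_injective this
  rw [h2] at h1
  rw [← Ideal.height_eq_zero_iff]
  nth_rw 2 [← zero_add 1] at h1
  rw [ENat.add_le_add_iff_right ENat.one_ne_top, nonpos_iff_eq_zero] at h1
  exact h1

theorem HasIsolatedSingularity.isField (hsing : HasIsolatedSingularity A)
    (hdim : ringKrullDim A = 1) (p : Ideal A) [p.IsPrime] (hp : p ∈ minimalPrimes A) :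
    IsField (Localization.AtPrime p) := by
  have := hsing p fun h => maximalIdeal_notMem_minimalPrimes hdim (h ▸ hp)
  have h := IsRegularLocalRing.spanFinrank_maximalIdeal (R := Localization.AtPrime p)
  rw [IsLocalization.AtPrime.ringKrullDim_eq_height p, Ideal.height_eq_zero_iff.mpr hp] at h
  rw [isField_iff_maximalIdeal_eq]
  have h' : (maximalIdeal (Localization.AtPrime p)).spanFinrank = 0 := by exact_mod_cast h
  exact (Submodule.spanFinrank_eq_zero_iff_eq_bot
    (maximalIdeal (Localization.AtPrime p)).fg_of_isNoetherianRing).mp h'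

/-- A minimal prime is principal, generated by one member of a pair of elements that generate each
other's annihilators. -/
theorem HasPeriodicResolutions.exists_exactPair (hper : HasPeriodicResolutions A)
    (hsing : HasIsolatedSingularity A) (hdim : ringKrullDim A = 1)
    {x : A} (hx : x ∈ maximalIdeal A) (hreg : IsSMulRegular A x)
    (p : Ideal A) [hpp : p.IsPrime] (hp : p ∈ minimalPrimes A) :
    ∃ a b, p = Ideal.span {a} ∧ (∀ y, a * y = 0 ↔ y ∈ Ideal.span {b}) ∧
      (∀ y, b * y = 0 ↔ y ∈ Ideal.span {a}) ∧ b ∉ p := by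
  have hpm : p ≠ maximalIdeal A := fun h => maximalIdeal_notMem_minimalPrimes hdim (h ▸ hp)
  obtain ⟨z, hz, hzp⟩ := SetLike.exists_of_lt
    (lt_of_le_of_ne (le_maximalIdeal hpp.ne_top) hpm)
  obtain ⟨a, ha⟩ := hper.exists_eq_span_singleton hz p (by
    rw [isSMulRegular_iff_right_eq_zero_of_smul]
    intro y hy
    obtain ⟨y, rfl⟩ := Ideal.Quotient.mk_surjective y
    have hzy : z * y ∈ p := Ideal.Quotient.eq_zero_iff_mem.mp hy
    exact Ideal.Quotient.eq_zero_iff_mem.mpr ((hpp.mem_or_mem hzy).resolve_left hzp))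
  let I : Ideal A := LinearMap.ker (LinearMap.toSpanSingleton A A a)
  have hI (y : A) : y ∈ I ↔ a * y = 0 := by
    rw [LinearMap.mem_ker, LinearMap.toSpanSingleton_apply, smul_eq_mul, mul_comm]
  -- Multiplication by `a` embeds `A ⧸ I` in `A`, so `x` stays regular on it.
  obtain ⟨b, hb⟩ := hper.exists_eq_span_singleton hx I (by
    rw [isSMulRegular_iff_right_eq_zero_of_smul]
    intro y hy
    obtain ⟨y, rfl⟩ := Ideal.Quotient.mk_surjective y
    have hxy : x * y ∈ I := Ideal.Quotient.eq_zero_iff_mem.mp hy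
    rw [hI, mul_left_comm] at hxy
    exact Ideal.Quotient.eq_zero_iff_mem.mpr ((hI y).mpr (hreg.right_eq_zero_of_smul hxy)))
  have hab (y : A) : a * y = 0 ↔ y ∈ Ideal.span {b} := by rw [← hI, hb]
  -- In the field `A_p` the element `a` becomes zero, so some `s ∉ p` kills `a`, and `s ∈ (b)`.
  have hbp : b ∉ p := by
    intro hbp
    have hfield := hsing.isField hdim p hp
    have ha0 : algebraMap A (Localization.AtPrime p) a = 0 := by
      have hmem : algebraMap A (Localization.AtPrime p) a ∈
          maximalIdeal (Localization.AtPrime p) := by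
        rw [IsLocalization.AtPrime.to_map_mem_maximal_iff (Localization.AtPrime p) p]
        exact ha ▸ Ideal.mem_span_singleton_self a
      rwa [(isField_iff_maximalIdeal_eq).mp hfield] at hmem
    obtain ⟨s, hs⟩ := (IsLocalization.map_eq_zero_iff p.primeCompl _ a).mp ha0
    rw [mul_comm, hab] at hs
    exact s.2 ((Ideal.span_singleton_le_iff_mem _).mpr hbp hs)
  refine ⟨a, b, ha, hab, fun y => ⟨fun hy => ?_, fun hy => ?_⟩, hbp⟩
  · rw [← ha]
    exact (hpp.mem_or_mem (hy ▸ p.zero_mem : b * y ∈ p)).resolve_left hbp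
  · obtain ⟨c, rfl⟩ := Ideal.mem_span_singleton'.mp hy
    have : a * b = 0 := (hab b).mpr (Ideal.mem_span_singleton_self b)
    rw [mul_left_comm, mul_comm b a, this, mul_zero]

/-- The only prime above `J` is the maximal ideal, so `A ⧸ J` is Artinian, and `T` is a quotient of
a finite power of it. -/
theorem length_ne_top_of_forall_smul_eq_zero [IsNoetherianRing A] (hdim : ringKrullDim A = 1)
    {T : Type*} [AddCommGroup T] [Module A T] [Module.Finite A T] (J : Ideal A)
    (hJ : ∀ p ∈ minimalPrimes A, ¬ J ≤ p) (h : ∀ r ∈ J, ∀ t : T, r • t = 0) :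
    Module.length A T ≠ ⊤ := by
  have hprime (q : Ideal A) (hq : q.IsPrime) (hJq : J ≤ q) : q = maximalIdeal A := by
    by_contra hne
    exact hJ q (mem_minimalPrimes_of_ne_maximalIdeal hdim q hne) hJq
  have hart : IsArtinianRing (A ⧸ J) := by
    rw [isArtinianRing_iff_isNoetherianRing_krullDimLE_zero]
    refine ⟨inferInstance, Ring.KrullDimLE.mk₀ fun q hq => ?_⟩
    have hcomap : (q.comap (Ideal.Quotient.mk J)).IsMaximal := by
      rw [hprime _ (hq.comap _) fun y hy => ?_]
      · exact maximalIdeal.isMaximal A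
      · rw [Ideal.mem_comap, Ideal.Quotient.eq_zero_iff_mem.mpr hy]
        exact q.zero_mem
    have hmap := Ideal.map_comap_of_surjective (Ideal.Quotient.mk J) Ideal.Quotient.mk_surjective q
    rcases Ideal.map_eq_top_or_isMaximal_of_surjective (Ideal.Quotient.mk J)
        Ideal.Quotient.mk_surjective hcomap with
      h | h
    · exact absurd (hmap ▸ h) hq.ne_top
    · exact hmap ▸ h
  have hfin : Module.length A (A ⧸ J) ≠ ⊤ := by
    rw [Module.length_eq_of_surjective (R := A ⧸ J) Ideal.Quotient.mk_surjective]
    exact Module.length_ne_top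
  obtain ⟨n, π, hπ⟩ := Module.Finite.exists_fin' A T
  let σ : (Fin n → A) →ₗ[A] (Fin n → A ⧸ J) := J.mkQ.compLeft (Fin n)
  have hσ : Function.Surjective σ := J.mkQ_surjective.comp_left
  have hker : LinearMap.ker σ ≤ LinearMap.ker π := by
    intro y hy
    have hyJ (i : Fin n) : y i ∈ J := (Submodule.Quotient.mk_eq_zero J).mp (congrFun hy i)
    rw [LinearMap.mem_ker, LinearMap.pi_apply_eq_sum_univ π y]
    exact Finset.sum_eq_zero fun i _ => h _ (hyJ i) _
  have hπ' : Function.Surjective ((LinearMap.ker σ).liftQ π hker) := fun t => by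
    obtain ⟨y, rfl⟩ := hπ t
    exact ⟨Submodule.Quotient.mk y, rfl⟩
  refine ne_top_of_le_ne_top ?_ (Module.length_le_of_surjective _ hπ')
  rw [(σ.quotKerEquivOfSurjective hσ).length_eq]
  rw [Module.length_pi_of_fintype]
  exact ENat.sum_ne_top.mpr fun i _ => hfin

theorem length_tor_ne_top [IsNoetherianRing A] (hper : HasPeriodicResolutions A)
    (hsing : HasIsolatedSingularity A) (hdim : ringKrullDim A = 1)
    {x : A} (hx : x ∈ maximalIdeal A) (hreg : IsSMulRegular A x) (i : ℕ)
    (M N : Type u) [AddCommGroup M] [Module A M] [hM : Module.Finite A M] [AddCommGroup N]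
    [Module A N] [Module.Finite A N] : Module.length A (torModule A (i + 1) M N) ≠ ⊤ := by
  have hcongr {M M' : Type u} [AddCommGroup M] [Module A M] [AddCommGroup M'] [Module A M']
      (e : M ≃ₗ[A] M') (h : Module.length A (torModule A (i + 1) M' N) ≠ ⊤) :
      Module.length A (torModule A (i + 1) M N) ≠ ⊤ := by
    obtain ⟨e'⟩ := nonempty_tor_equiv_of_equiv e (i + 1) N
    rwa [e'.length_eq]
  induction hM using IsNoetherianRing.induction_on_isQuotientEquivQuotientPrime A with
  | subsingleton M =>
    have := subsingleton_tor_of_flat (A := A) (F := M) i N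
    rw [Module.length_eq_zero]
    exact ENat.zero_ne_top
  | quotient M p e =>
    refine hcongr e ?_
    have hpp : p.1.IsPrime := p.2
    have := finite_tor (A := A) i (A ⧸ p.1) N
    by_cases hpm : p.1 = maximalIdeal A
    · refine length_ne_top_of_forall_smul_eq_zero hdim p.1 (fun q hq hle => ?_)
        (fun r hr t => smul_tor_quotient_eq_zero p.1 i N hr t)
      have : q = maximalIdeal A := le_antisymm (le_maximalIdeal hq.1.1.ne_top) (hpm ▸ hle)
      exact maximalIdeal_notMem_minimalPrimes hdim (this ▸ hq)
    · have hp := mem_minimalPrimes_of_ne_maximalIdeal hdim p.1 hpm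
      obtain ⟨a, b, ha, hab, hba, hb⟩ := hper.exists_exactPair hsing hdim hx hreg p.1 hp
      rw [ha] at this ⊢
      refine length_ne_top_of_forall_smul_eq_zero hdim (Ideal.span {a} ⊔ Ideal.span {b})
        (fun q hq hle => ?_) (fun r hr t => smul_tor_eq_zero_of_mem_sup hba i N hr t)
      rw [sup_le_iff, ← ha] at hle
      have hqp : q ≤ p.1 := hq.2 ⟨hpp, bot_le⟩ hle.1
      exact hb (hqp (hle.2 (Ideal.mem_span_singleton_self b)))
  | exact M₁ M₂ M₃ f g hf hg hfg h₁ h₃ =>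
    obtain ⟨α, β, δ, h⟩ := exists_tor_longExact f g hf hfg hg N
    have hex := (h (i + 1)).1
    rw [Module.length_eq_add_of_exact (LinearMap.ker (β (i + 1))).subtype
      (β (i + 1)).rangeRestrict Subtype.val_injective (LinearMap.surjective_rangeRestrict _)
      (by rw [LinearMap.exact_iff, Submodule.range_subtype, LinearMap.ker_rangeRestrict])]
    rw [hex.linearMap_ker_eq]
    refine WithTop.add_ne_top.mpr ⟨?_, ?_⟩
    · exact ne_top_of_le_ne_top h₁
        (Module.length_le_of_surjective _ (α (i + 1)).surjective_rangeRestrict)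
    · exact ne_top_of_le_ne_top h₃
        (Module.length_le_of_injective (LinearMap.range (β (i + 1))).subtype
          Subtype.val_injective)

end DimensionOne

/-! ### Hochster's theta: independence of the index and additivity -/

section ThetaInvariant

open IsLocalRing

variable {A : Type u} [CommRing A]

theorem subsingleton_tor_one_quotient_of_isSMulRegular {a b : A}
    (hab : ∀ y, a * y = 0 ↔ y ∈ Ideal.span {b}) (N : Type u) [AddCommGroup N] [Module A N]
    (ha : IsSMulRegular N a) : Subsingleton (torModule A 1 (A ⧸ Ideal.span {a}) N) := by
  obtain ⟨k, hk, hex, hkm⟩ := exists_syzygy_quotient_span_singleton hab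
  obtain ⟨e⟩ := nonempty_tor_one_equiv hk hex (Submodule.mkQ_surjective _) N
  suffices LinearMap.ker (k.rTensor N) = ⊥ by
    rw [this] at e
    exact e.toEquiv.subsingleton
  refine (Submodule.eq_bot_iff _).mpr fun z hz => ?_
  obtain ⟨y, rfl⟩ := TensorProduct.mk_surjective A N (A ⧸ Ideal.span {b})
    Ideal.Quotient.mk_surjective z
  have hz' := congrArg (TensorProduct.lid A N) (LinearMap.mem_ker.mp hz)
  have h1 : k 1 = a := (hkm 1).trans (one_mul a)
  rw [TensorProduct.mk_apply, LinearMap.rTensor_tmul, TensorProduct.lid_tmul, h1, map_zero] at hz'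
  rw [ha.right_eq_zero_of_smul hz', map_zero]

/-- As `a` acts as zero on `A ⧸ I`, this `Tor₁` is all of `A ⧸ (b) ⊗ A ⧸ I`, which maps to the
residue field as a ring and so is nonzero. -/
theorem nontrivial_tor_one_quotient [IsLocalRing A] {a b : A}
    (hab : ∀ y, a * y = 0 ↔ y ∈ Ideal.span {b}) (I : Ideal A) (hI : I ≠ ⊤) (ha : a ∈ I)
    (hb : b ∈ maximalIdeal A) : Nontrivial (torModule A 1 (A ⧸ Ideal.span {a}) (A ⧸ I)) := by
  obtain ⟨k, hk, hex, hkm⟩ := exists_syzygy_quotient_span_singleton hab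
  obtain ⟨e⟩ := nonempty_tor_one_equiv hk hex (Submodule.mkQ_surjective _) (A ⧸ I)
  have hker : LinearMap.ker (k.rTensor (A ⧸ I)) = ⊤ := by
    refine (Submodule.eq_top_iff'.mpr fun z => ?_)
    obtain ⟨y, rfl⟩ := TensorProduct.mk_surjective A (A ⧸ I) (A ⧸ Ideal.span {b})
      Ideal.Quotient.mk_surjective z
    obtain ⟨y, rfl⟩ := Ideal.Quotient.mk_surjective y
    have h1 : k 1 = a := (hkm 1).trans (one_mul a)
    apply (TensorProduct.lid A (A ⧸ I)).injective
    rw [TensorProduct.mk_apply, LinearMap.rTensor_tmul, TensorProduct.lid_tmul, h1, map_zero]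
    exact Ideal.Quotient.eq_zero_iff_mem.mpr (I.mul_mem_right y ha)
  rw [hker] at e
  have := (Algebra.TensorProduct.productMap
    (Ideal.Quotient.factorₐ A ((Ideal.span_singleton_le_iff_mem _).mpr hb))
    (Ideal.Quotient.factorₐ A (le_maximalIdeal hI))).toRingHom.domain_nontrivial
  exact (e.trans Submodule.topEquiv).toEquiv.nontrivial

theorem length_toNat_eq_of_exact {X Y Z : Type*} [AddCommGroup X] [Module A X] [AddCommGroup Y]
    [Module A Y] [AddCommGroup Z] [Module A Z] {f : X →ₗ[A] Y} {g : Y →ₗ[A] Z}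
    (h : Function.Exact f g) (hY : Module.length A Y ≠ ⊤) :
    (Module.length A Y).toNat =
      (Module.length A (LinearMap.range f)).toNat + (Module.length A (LinearMap.range g)).toNat := by
  have := Module.length_eq_add_of_exact (LinearMap.ker g).subtype
      g.rangeRestrict Subtype.val_injective (LinearMap.surjective_rangeRestrict _)
      (by rw [LinearMap.exact_iff, Submodule.range_subtype, LinearMap.ker_rangeRestrict])
  rw [h.linearMap_ker_eq] at this
  rw [this] at hY ⊢
  exact ENat.toNat_add (WithTop.add_ne_top.mp hY).1 (WithTop.add_ne_top.mp hY).2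

theorem hochsterTheta_congr {M M' : Type u} [AddCommGroup M] [Module A M] [AddCommGroup M']
    [Module A M'] (φ : M ≃ₗ[A] M') (e : ℕ) (N : Type u) [AddCommGroup N] [Module A N] :
    hochsterTheta A e M N = hochsterTheta A e M' N := by
  obtain ⟨e₁⟩ := nonempty_tor_equiv_of_equiv φ (2 * e + 2) N
  obtain ⟨e₂⟩ := nonempty_tor_equiv_of_equiv φ (2 * e + 1) N
  rw [hochsterTheta, hochsterTheta, e₁.length_eq, e₂.length_eq]

theorem hochsterTheta_comm (e : ℕ) (M N : Type u) [AddCommGroup M] [Module A M] [AddCommGroup N]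
    [Module A N] : hochsterTheta A e M N = hochsterTheta A e N M := by
  obtain ⟨e₁⟩ := nonempty_tor_comm (A := A) M N (2 * e + 1)
  obtain ⟨e₂⟩ := nonempty_tor_comm (A := A) M N (2 * e)
  rw [hochsterTheta, hochsterTheta, e₁.length_eq, e₂.length_eq]

theorem hochsterTheta_eq_zero_of_flat (e : ℕ) (F N : Type u) [AddCommGroup F] [Module A F]
    [Module.Flat A F] [AddCommGroup N] [Module A N] : hochsterTheta A e F N = 0 := by
  have := subsingleton_tor_of_flat (A := A) (F := F) (2 * e + 1) N
  have := subsingleton_tor_of_flat (A := A) (F := F) (2 * e) N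
  rw [hochsterTheta, Module.length_eq_zero, Module.length_eq_zero, sub_self]

/-- The one-dimensional local rings with isolated singularity to which the theory below applies;
hypersurfaces are examples. -/
structure IsPeriodicCurve (A : Type u) [CommRing A] [IsLocalRing A] : Prop where
  noetherian : IsNoetherianRing A
  periodic : HasPeriodicResolutions A
  isolated : HasIsolatedSingularity A
  dim_eq_one : ringKrullDim A = 1
  exists_regular : ∃ x ∈ maximalIdeal A, IsSMulRegular A x

theorem IsLocalHypersurface.isPeriodicCurve [IsLocalRing A] (hA : IsLocalHypersurface A)
    (hsing : HasIsolatedSingularity A) (hdim : ringKrullDim A = 1) : IsPeriodicCurve A :=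
  ⟨hA.1, (hA.exists_periodic hdim).2, hsing, hdim, (hA.exists_periodic hdim).1⟩

namespace IsPeriodicCurve

variable [IsLocalRing A]

theorem length_tor_ne_top (H : IsPeriodicCurve A) (i : ℕ) (M N : Type u) [AddCommGroup M]
    [Module A M] [Module.Finite A M] [AddCommGroup N] [Module A N] [Module.Finite A N] :
    Module.length A (torModule A (i + 1) M N) ≠ ⊤ := by
  have := H.noetherian
  obtain ⟨x, hx, hreg⟩ := H.exists_regular
  exact _root_.length_tor_ne_top H.periodic H.isolated H.dim_eq_one hx hreg i M N

theorem length_tor_add_two (H : IsPeriodicCurve A) (i : ℕ) (M N : Type u) [AddCommGroup M]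
    [Module A M] [Module.Finite A M] [AddCommGroup N] [Module A N] :
    Module.length A (torModule A (i + 4) M N) = Module.length A (torModule A (i + 2) M N) := by
  have := H.noetherian
  obtain ⟨x, hx, hreg⟩ := H.exists_regular
  obtain ⟨e⟩ := H.periodic.nonempty_tor_equiv' hx hreg M i N
  exact e.length_eq

/-- The index starts at one because periodicity is available only from degree two on, while index
zero would involve `Tor₁`. -/
theorem hochsterTheta_succ (H : IsPeriodicCurve A) (e : ℕ) (M N : Type u) [AddCommGroup M]
    [Module A M] [Module.Finite A M] [AddCommGroup N] [Module A N] :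
    hochsterTheta A (e + 1) M N = hochsterTheta A 1 M N := by
  induction e with
  | zero => rfl
  | succ e ih =>
    rw [← ih, hochsterTheta, hochsterTheta]
    congr 3
    · exact H.length_tor_add_two (2 * e + 2) M N
    · exact H.length_tor_add_two (2 * e + 1) M N

theorem hochsterTheta_add_of_exact (H : IsPeriodicCurve A) {M' M M'' : Type u} [AddCommGroup M']
    [Module A M'] [Module.Finite A M'] [AddCommGroup M] [Module A M] [Module.Finite A M]
    [AddCommGroup M''] [Module A M''] [Module.Finite A M''] {f : M' →ₗ[A] M} {g : M →ₗ[A] M''}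
    (hf : Function.Injective f) (hfg : Function.Exact f g) (hg : Function.Surjective g)
    (N : Type u) [AddCommGroup N] [Module A N] [Module.Finite A N] :
    hochsterTheta A 1 M N = hochsterTheta A 1 M' N + hochsterTheta A 1 M'' N := by
  obtain ⟨α, β, δ, h⟩ := exists_tor_longExact f g hf hfg hg N
  let len (i : ℕ) (X : Type u) [AddCommGroup X] [Module A X] : ℕ :=
    (Module.length A (torModule A i X N)).toNat
  let a (i : ℕ) : ℕ := (Module.length A (LinearMap.range (α i))).toNat
  let b (i : ℕ) : ℕ := (Module.length A (LinearMap.range (β i))).toNat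
  let c (i : ℕ) : ℕ := (Module.length A (LinearMap.range (δ i))).toNat
  have h' (i : ℕ) : len (i + 1) M' = c (i + 1) + a (i + 1) :=
    length_toNat_eq_of_exact (h (i + 1)).2.2 (H.length_tor_ne_top i M' N)
  have h₀ (i : ℕ) : len (i + 1) M = a (i + 1) + b (i + 1) :=
    length_toNat_eq_of_exact (h (i + 1)).1 (H.length_tor_ne_top i M N)
  have h'' (i : ℕ) : len (i + 1) M'' = b (i + 1) + c i :=
    length_toNat_eq_of_exact (h i).2.1 (H.length_tor_ne_top i M'' N)
  have hθ (e : ℕ) (X : Type u) [AddCommGroup X] [Module A X] [Module.Finite A X] :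
      hochsterTheta A 1 X N = len (2 * e + 4) X - len (2 * e + 3) X :=
    (H.hochsterTheta_succ e X N).symm
  let D : ℤ := hochsterTheta A 1 M' N - hochsterTheta A 1 M N + hochsterTheta A 1 M'' N
  -- In the alternating sum of lengths over two consecutive degrees everything cancels except the
  -- two outer connecting images. By periodicity the result does not depend on `e`.
  have hD (e : ℕ) : (c (2 * e + 4) : ℤ) - c (2 * e + 2) = D := by
    simp only [D]
    rw [hθ e M', hθ e M, hθ e M'', h' (2 * e + 2), h' (2 * e + 3), h₀ (2 * e + 2), h₀ (2 * e + 3),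
      h'' (2 * e + 2), h'' (2 * e + 3)]
    push_cast
    ring
  have hbound (e : ℕ) : c (2 * e + 2) ≤ len 2 M' := by
    have hper : len (2 * e + 2) M' = len 2 M' := by
      induction e with
      | zero => rfl
      | succ e ih => exact (congrArg ENat.toNat (H.length_tor_add_two (2 * e) M' N)).trans ih
    rw [← hper, h' (2 * e + 1)]
    exact Nat.le_add_right _ _
  have hlin (e : ℕ) : (c (2 * e + 2) : ℤ) = c 2 + e * D := by
    induction e with
    | zero => simp
    | succ e ih =>
      have := hD e
      rw [show 2 * (e + 1) + 2 = 2 * e + 4 by ring]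
      push_cast
      linarith
  -- The numbers `c (2 * e + 2)` form an arithmetic progression with values in `[0, len 2 M']`; `len
  -- 2 M' + 1` steps of a nonzero integer would leave this interval.
  have hD0 : D = 0 := by
    by_contra hne
    have hu := hbound (len 2 M' + 1)
    have hu₀ := hbound 0
    have hl := hlin (len 2 M' + 1)
    zify at hu hu₀
    push_cast at hl
    simp only [mul_zero, zero_add] at hu₀
    rcases lt_or_gt_of_ne hne with hlt | hgt
    · nlinarith
    · nlinarith
  simp only [D] at hD0
  linarith

end IsPeriodicCurve

end ThetaInvariant

/-! ### Theta in terms of the ranks at the minimal primes -/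

section RankFormula

open IsLocalRing Module

variable {A : Type u} [CommRing A]

theorem rankAtStalk_eq_zero_of_smul_eq_zero {M : Type*} [AddCommGroup M] [Module A M]
    (p : PrimeSpectrum A) {s : A} (hs : s ∉ p.asIdeal) (h : ∀ m : M, s • m = 0) :
    rankAtStalk M p = 0 := by
  have : Subsingleton (LocalizedModule p.asIdeal.primeCompl M) :=
    notMem_support_iff.mp (notMem_support_iff'.mpr fun m => ⟨s, hs, h m⟩)
  exact finrank_zero_of_subsingleton

theorem rankAtStalk_add_of_exact (p : PrimeSpectrum A)
    [IsDomain (Localization.AtPrime p.asIdeal)] {M' M M'' : Type u}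
    [AddCommGroup M'] [Module A M'] [AddCommGroup M] [Module A M] [Module.Finite A M]
    [AddCommGroup M''] [Module A M''] {f : M' →ₗ[A] M} {g : M →ₗ[A] M''}
    (hf : Function.Injective f) (hfg : Function.Exact f g) (hg : Function.Surjective g) :
    rankAtStalk M p = rankAtStalk M' p + rankAtStalk M'' p := by
  let S := p.asIdeal.primeCompl
  let f' := LocalizedModule.map S f
  let g' := LocalizedModule.map S g
  have hf' : Function.Injective f' := IsLocalizedModule.map_injective S _ _ f hf
  have hg' : Function.Surjective g' := IsLocalizedModule.map_surjective S _ _ g hg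
  have hfg' : Function.Exact f' g' := LocalizedModule.map_exact S f g hfg
  have h := (LinearMap.range f').finrank_quotient_add_finrank
  rw [LinearMap.finrank_range_of_inj hf', ← hfg'.linearMap_ker_eq,
    (g'.quotKerEquivOfSurjective hg').finrank_eq] at h
  rw [rankAtStalk, rankAtStalk, rankAtStalk, ← h, add_comm]

variable [IsLocalRing A]

namespace IsPeriodicCurve

theorem finite_setOf_mem_minimalPrimes (H : IsPeriodicCurve A) :
    {p : PrimeSpectrum A | p.asIdeal ∈ minimalPrimes A}.Finite := by
  have := H.noetherian
  exact (minimalPrimes.finite_of_isNoetherianRing A).preimage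
    fun p _ q _ h => PrimeSpectrum.ext h

/-- The minimal primes of `A`. -/
noncomputable def minimalSpectrum (H : IsPeriodicCurve A) : Finset (PrimeSpectrum A) :=
  H.finite_setOf_mem_minimalPrimes.toFinset

theorem mem_minimalSpectrum (H : IsPeriodicCurve A) {p : PrimeSpectrum A} :
    p ∈ H.minimalSpectrum ↔ p.asIdeal ∈ minimalPrimes A :=
  Set.Finite.mem_toFinset _

theorem exists_exactPair (H : IsPeriodicCurve A) {p : PrimeSpectrum A}
    (hp : p ∈ H.minimalSpectrum) :
    ∃ a b, p.asIdeal = Ideal.span {a} ∧ (∀ y, a * y = 0 ↔ y ∈ Ideal.span {b}) ∧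
      (∀ y, b * y = 0 ↔ y ∈ Ideal.span {a}) ∧ b ∉ p.asIdeal := by
  obtain ⟨x, hx, hreg⟩ := H.exists_regular
  exact H.periodic.exists_exactPair H.isolated H.dim_eq_one hx hreg p.asIdeal
    (H.mem_minimalSpectrum.mp hp)

theorem eq_of_le (H : IsPeriodicCurve A) {p q : PrimeSpectrum A} (hq : q ∈ H.minimalSpectrum)
    (h : p.asIdeal ≤ q.asIdeal) : p = q :=
  PrimeSpectrum.ext (h.antisymm ((H.mem_minimalSpectrum.mp hq).2 ⟨p.2, bot_le⟩ h))

theorem rankAtStalk_add_of_exact (H : IsPeriodicCurve A) {p : PrimeSpectrum A}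
    (hp : p ∈ H.minimalSpectrum) {M' M M'' : Type u}
    [AddCommGroup M'] [Module A M'] [AddCommGroup M] [Module A M] [Module.Finite A M]
    [AddCommGroup M''] [Module A M''] {f : M' →ₗ[A] M} {g : M →ₗ[A] M''}
    (hf : Function.Injective f) (hfg : Function.Exact f g) (hg : Function.Surjective g) :
    rankAtStalk M p = rankAtStalk M' p + rankAtStalk M'' p := by
  have := (H.isolated.isField H.dim_eq_one p.asIdeal (H.mem_minimalSpectrum.mp hp)).isDomain
  exact _root_.rankAtStalk_add_of_exact p hf hfg hg

theorem rankAtStalk_quotient_of_ne (H : IsPeriodicCurve A) {p q : PrimeSpectrum A}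
    (hq : q ∈ H.minimalSpectrum) (hne : p ≠ q) : rankAtStalk (A ⧸ p.asIdeal) q = 0 := by
  obtain ⟨s, hs, hsq⟩ := SetLike.not_le_iff_exists.mp (mt (H.eq_of_le hq) hne)
  refine rankAtStalk_eq_zero_of_smul_eq_zero q hsq fun m => ?_
  obtain ⟨m, rfl⟩ := Ideal.Quotient.mk_surjective m
  exact Ideal.Quotient.eq_zero_iff_mem.mpr (Ideal.mul_mem_right m _ hs)

/-- The ideal `q` is killed by `b ∉ q`, so it contributes nothing to the rank of `A`. -/
theorem rankAtStalk_quotient_self (H : IsPeriodicCurve A) {q : PrimeSpectrum A}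
    (hq : q ∈ H.minimalSpectrum) : rankAtStalk (A ⧸ q.asIdeal) q = 1 := by
  obtain ⟨a, b, ha, hab, hba, hb⟩ := H.exists_exactPair hq
  have h := H.rankAtStalk_add_of_exact hq (f := q.asIdeal.subtype) (g := q.asIdeal.mkQ)
    Subtype.val_injective (by rw [LinearMap.exact_iff, Submodule.range_subtype, Submodule.ker_mkQ])
    q.asIdeal.mkQ_surjective
  have h0 : rankAtStalk q.asIdeal q = 0 := rankAtStalk_eq_zero_of_smul_eq_zero q hb fun m =>
    Subtype.ext ((hba m).mpr (ha ▸ m.2))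
  rw [h0, zero_add, rankAtStalk_self, Pi.one_apply] at h
  exact h.symm

/-- In the alternating resolution of `A ⧸ p`, `a` is regular on `A ⧸ q` and `b ∈ q` acts as zero.
Thus `Tor₃` vanishes, whereas `Tor₄` reduces to a nonzero `Tor₁` of `A ⧸ (b)`. -/
theorem hochsterTheta_quotient_pos (H : IsPeriodicCurve A) {p q : PrimeSpectrum A}
    (hp : p ∈ H.minimalSpectrum) (hq : q ∈ H.minimalSpectrum) (hne : p ≠ q) :
    0 < hochsterTheta A 1 (A ⧸ p.asIdeal) (A ⧸ q.asIdeal) := by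
  obtain ⟨a, b, ha, hab, hba, hb⟩ := H.exists_exactPair hp
  have haq : a ∉ q.asIdeal := fun h => hne (H.eq_of_le hq
    (by rwa [ha, Ideal.span_singleton_le_iff_mem]))
  have hbq : b ∈ q.asIdeal := by
    have hab0 : a * b = 0 := (hab b).mpr (Ideal.mem_span_singleton_self b)
    exact (q.2.mem_or_mem (hab0 ▸ q.asIdeal.zero_mem : a * b ∈ q.asIdeal)).resolve_left haq
  have ham : a ∈ maximalIdeal A :=
    le_maximalIdeal p.2.ne_top (ha ▸ Ideal.mem_span_singleton_self a)
  have hreg : IsSMulRegular (A ⧸ q.asIdeal) a := by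
    rw [isSMulRegular_iff_right_eq_zero_of_smul]
    intro y hy
    obtain ⟨y, rfl⟩ := Ideal.Quotient.mk_surjective y
    have hay : a * y ∈ q.asIdeal := Ideal.Quotient.eq_zero_iff_mem.mp hy
    exact Ideal.Quotient.eq_zero_iff_mem.mpr ((q.2.mem_or_mem hay).resolve_left haq)
  have hfin := H.length_tor_ne_top 3 (A ⧸ p.asIdeal) (A ⧸ q.asIdeal)
  rw [hochsterTheta]
  rw [ha] at hfin ⊢
  have := subsingleton_tor_one_quotient_of_isSMulRegular hab (A ⧸ q.asIdeal) hreg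
  have := nontrivial_tor_one_quotient hba q.asIdeal q.2.ne_top hbq ham
  have shift (i : ℕ) : Nonempty (torModule A (i + 3) (A ⧸ Ideal.span {a}) (A ⧸ q.asIdeal) ≃ₗ[A]
      torModule A (i + 1) (A ⧸ Ideal.span {a}) (A ⧸ q.asIdeal)) := by
    obtain ⟨e₁⟩ := nonempty_tor_quotient_span_singleton_equiv hab (i + 1) (A ⧸ q.asIdeal)
    obtain ⟨e₂⟩ := nonempty_tor_quotient_span_singleton_equiv hba i (A ⧸ q.asIdeal)
    exact ⟨e₁.trans e₂⟩
  obtain ⟨e₁⟩ := shift 0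
  obtain ⟨e₂⟩ := shift 1
  obtain ⟨e₃⟩ := nonempty_tor_quotient_span_singleton_equiv hab 0 (A ⧸ q.asIdeal)
  have h3 : Module.length A (torModule A 3 (A ⧸ Ideal.span {a}) (A ⧸ q.asIdeal)) = 0 :=
    e₁.length_eq.trans Module.length_eq_zero
  have h4 : Module.length A (torModule A 4 (A ⧸ Ideal.span {a}) (A ⧸ q.asIdeal)) ≠ 0 := by
    rw [(e₂.trans e₃).length_eq]
    exact Module.length_pos.ne'
  change (0 : ℤ) < ((Module.length A (torModule A 4 (A ⧸ Ideal.span {a}) _)).toNat : ℤ) -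
    ((Module.length A (torModule A 3 (A ⧸ Ideal.span {a}) _)).toNat : ℤ)
  rw [h3, ENat.toNat_zero, Nat.cast_zero, sub_zero, Nat.cast_pos, Nat.pos_iff_ne_zero, Ne,
    ENat.toNat_eq_zero, not_or]
  exact ⟨h4, hfin⟩

/-- In a prime filtration of `M`, `t` counts the factors `A ⧸ 𝔪`. The first clause serves to detect
`t ≠ 0` for a nonzero module whose ranks all vanish. -/
theorem exists_hochsterTheta_eq_add_sum (H : IsPeriodicCurve A) (M : Type u) [AddCommGroup M]
    [Module A M] [hM : Module.Finite A M] :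
    ∃ t : ℕ, (t = 0 → (∀ p ∈ H.minimalSpectrum, rankAtStalk M p = 0) → Subsingleton M) ∧
      ∀ (N : Type u) [AddCommGroup N] [Module A N] [Module.Finite A N],
        hochsterTheta A 1 M N = t * hochsterTheta A 1 (A ⧸ maximalIdeal A) N +
          ∑ p ∈ H.minimalSpectrum, rankAtStalk M p * hochsterTheta A 1 (A ⧸ p.asIdeal) N := by
  have := H.noetherian
  induction hM using IsNoetherianRing.induction_on_isQuotientEquivQuotientPrime A with
  | subsingleton M =>
    refine ⟨0, fun _ _ => inferInstance, fun N _ _ _ => ?_⟩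
    simp [hochsterTheta_eq_zero_of_flat]
  | quotient M p e =>
    by_cases hpm : p.asIdeal = maximalIdeal A
    · refine ⟨1, by simp, fun N _ _ _ => ?_⟩
      rw [hochsterTheta_congr e, rankAtStalk_eq_of_equiv e, Finset.sum_eq_zero, ← hpm]
      · simp
      · intro q hq
        rw [H.rankAtStalk_quotient_of_ne hq, Nat.cast_zero, zero_mul]
        rintro rfl
        exact maximalIdeal_notMem_minimalPrimes H.dim_eq_one (hpm ▸ H.mem_minimalSpectrum.mp hq)
    · have hp : p ∈ H.minimalSpectrum := H.mem_minimalSpectrum.mpr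
        (mem_minimalPrimes_of_ne_maximalIdeal H.dim_eq_one p.asIdeal hpm)
      refine ⟨0, fun _ h => ?_, fun N _ _ _ => ?_⟩
      · have := h p hp
        rw [rankAtStalk_eq_of_equiv e, H.rankAtStalk_quotient_self hp] at this
        exact absurd this one_ne_zero
      · rw [hochsterTheta_congr e, rankAtStalk_eq_of_equiv e, Finset.sum_eq_single p,
          H.rankAtStalk_quotient_self hp]
        · simp
        · intro q hq hne
          rw [H.rankAtStalk_quotient_of_ne hq hne.symm, Nat.cast_zero, zero_mul]
        · exact fun h => absurd hp h
  | exact M₁ M₂ M₃ f g hf hg hfg h₁ h₃ =>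
    obtain ⟨t₁, ht₁, h₁⟩ := h₁
    obtain ⟨t₃, ht₃, h₃⟩ := h₃
    have hr (p : PrimeSpectrum A) (hp : p ∈ H.minimalSpectrum) :=
      H.rankAtStalk_add_of_exact hp hf hfg hg
    refine ⟨t₁ + t₃, fun ht h => ?_, fun N _ _ _ => ?_⟩
    · have s₁ := ht₁ (by omega) fun p hp => by have := h p hp; have := hr p hp; omega
      have s₃ := ht₃ (by omega) fun p hp => by have := h p hp; have := hr p hp; omega
      refine subsingleton_of_forall_eq 0 fun m => ?_
      obtain ⟨m', rfl⟩ := (hfg m).mp (Subsingleton.elim _ _)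
      rw [Subsingleton.elim m' 0, map_zero]
    · have hsum : ∑ p ∈ H.minimalSpectrum, rankAtStalk M₂ p * hochsterTheta A 1 (A ⧸ p.asIdeal) N =
          ∑ p ∈ H.minimalSpectrum, rankAtStalk M₁ p * hochsterTheta A 1 (A ⧸ p.asIdeal) N +
          ∑ p ∈ H.minimalSpectrum, rankAtStalk M₃ p * hochsterTheta A 1 (A ⧸ p.asIdeal) N := by
        rw [← Finset.sum_add_distrib]
        exact Finset.sum_congr rfl fun p hp => by rw [hr p hp, Nat.cast_add, add_mul]
      rw [H.hochsterTheta_add_of_exact hf hfg hg, h₁, h₃, hsum]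
      push_cast
      ring

/-- For regular `x`, the nonzero module `A ⧸ (x)` has zero ranks and, by additivity, zero theta. So
a nonzero multiple of the left side is zero. -/
theorem hochsterTheta_residueField (H : IsPeriodicCurve A) (N : Type u) [AddCommGroup N]
    [Module A N] [Module.Finite A N] : hochsterTheta A 1 (A ⧸ maximalIdeal A) N = 0 := by
  obtain ⟨x, hx, hreg⟩ := H.exists_regular
  obtain ⟨t, ht, h⟩ := H.exists_hochsterTheta_eq_add_sum (A ⧸ Ideal.span {x})
  have hf : Function.Injective (LinearMap.toSpanSingleton A A x) :=
    fun y z hyz => hreg (by simpa [mul_comm] using hyz)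
  have hfg : Function.Exact (LinearMap.toSpanSingleton A A x) (Ideal.span {x}).mkQ := by
    rw [LinearMap.exact_iff, Submodule.ker_mkQ, LinearMap.range_toSpanSingleton]
  have hg := (Ideal.span {x}).mkQ_surjective
  have hr (p : PrimeSpectrum A) (hp : p ∈ H.minimalSpectrum) :
      rankAtStalk (A ⧸ Ideal.span {x}) p = 0 := by
    have := H.rankAtStalk_add_of_exact hp hf hfg hg
    omega
  have h0 := H.hochsterTheta_add_of_exact hf hfg hg N
  rw [hochsterTheta_eq_zero_of_flat, zero_add, h, Finset.sum_eq_zero fun p hp => by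
    rw [hr p hp, Nat.cast_zero, zero_mul], add_zero] at h0
  refine (mul_eq_zero.mp h0.symm).resolve_left fun ht0 => ?_
  have := ht (by exact_mod_cast ht0) hr
  rw [Submodule.Quotient.subsingleton_iff, Ideal.span_singleton_eq_top] at this
  exact hx this

theorem hochsterTheta_eq_sum (H : IsPeriodicCurve A) (M N : Type u) [AddCommGroup M] [Module A M]
    [Module.Finite A M] [AddCommGroup N] [Module A N] [Module.Finite A N] :
    hochsterTheta A 1 M N =
      ∑ p ∈ H.minimalSpectrum, rankAtStalk M p * hochsterTheta A 1 (A ⧸ p.asIdeal) N := by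
  obtain ⟨t, -, h⟩ := H.exists_hochsterTheta_eq_add_sum M
  rw [h, H.hochsterTheta_residueField, mul_zero, zero_add]

/-- The rank formula for `A` itself, which is flat of rank one everywhere. -/
theorem sum_hochsterTheta_quotient (H : IsPeriodicCurve A) (N : Type u) [AddCommGroup N]
    [Module A N] [Module.Finite A N] :
    ∑ p ∈ H.minimalSpectrum, hochsterTheta A 1 (A ⧸ p.asIdeal) N = 0 := by
  have h := H.hochsterTheta_eq_sum A N
  simpa [hochsterTheta_eq_zero_of_flat] using h.symm

/-- Hochster's theta as a quadratic expression in the differences of the ranks at the minimal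
primes. -/
theorem neg_two_mul_hochsterTheta (H : IsPeriodicCurve A) (M N : Type u) [AddCommGroup M]
    [Module A M] [Module.Finite A M] [AddCommGroup N] [Module A N] [Module.Finite A N] :
    -2 * hochsterTheta A 1 M N = ∑ p ∈ H.minimalSpectrum, ∑ q ∈ H.minimalSpectrum,
      hochsterTheta A 1 (A ⧸ p.asIdeal) (A ⧸ q.asIdeal) *
        ((rankAtStalk M p - rankAtStalk M q) * (rankAtStalk N p - rankAtStalk N q)) := by
  set s := H.minimalSpectrum
  let w (p q : PrimeSpectrum A) : ℤ := hochsterTheta A 1 (A ⧸ p.asIdeal) (A ⧸ q.asIdeal)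
  have hw (p q : PrimeSpectrum A) : w p q = w q p := hochsterTheta_comm _ _ _
  have hcol (q : PrimeSpectrum A) : ∑ p ∈ s, w p q = 0 := H.sum_hochsterTheta_quotient _
  have hrow (p : PrimeSpectrum A) : ∑ q ∈ s, w p q = 0 := by
    rw [← hcol p]
    exact Finset.sum_congr rfl fun q _ => hw p q
  have hθ : hochsterTheta A 1 M N =
      ∑ p ∈ s, ∑ q ∈ s, w p q * (rankAtStalk M p * rankAtStalk N q) := by
    rw [H.hochsterTheta_eq_sum M N]
    refine Finset.sum_congr rfl fun p _ => ?_
    rw [hochsterTheta_comm, H.hochsterTheta_eq_sum N, Finset.mul_sum]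
    refine Finset.sum_congr rfl fun q _ => ?_
    rw [hochsterTheta_comm]
    simp only [w]
    ring
  have hθ' : hochsterTheta A 1 M N =
      ∑ p ∈ s, ∑ q ∈ s, w p q * (rankAtStalk M q * rankAtStalk N p) := by
    rw [hθ, Finset.sum_comm]
    exact Finset.sum_congr rfl fun p _ => Finset.sum_congr rfl fun q _ => by rw [hw]
  -- When the product of differences is expanded, the terms with both ranks at the same prime drop
  -- out because rows and columns of `w` sum to zero.
  have h1 : ∑ p ∈ s, ∑ q ∈ s, w p q * ((rankAtStalk M p : ℤ) * rankAtStalk N p) = 0 :=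
    Finset.sum_eq_zero fun p _ => by rw [← Finset.sum_mul, hrow, zero_mul]
  have h2 : ∑ p ∈ s, ∑ q ∈ s, w p q * ((rankAtStalk M q : ℤ) * rankAtStalk N q) = 0 := by
    rw [Finset.sum_comm]
    exact Finset.sum_eq_zero fun p _ => by rw [← Finset.sum_mul, hcol, zero_mul]
  have hsum : ∑ p ∈ s, ∑ q ∈ s, w p q *
      (((rankAtStalk M p : ℤ) - rankAtStalk M q) * (rankAtStalk N p - rankAtStalk N q)) =
      (∑ p ∈ s, ∑ q ∈ s, w p q * ((rankAtStalk M p : ℤ) * rankAtStalk N p)) -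
      (∑ p ∈ s, ∑ q ∈ s, w p q * ((rankAtStalk M p : ℤ) * rankAtStalk N q)) -
      (∑ p ∈ s, ∑ q ∈ s, w p q * ((rankAtStalk M q : ℤ) * rankAtStalk N p)) +
      ∑ p ∈ s, ∑ q ∈ s, w p q * ((rankAtStalk M q : ℤ) * rankAtStalk N q) := by
    simp only [← Finset.sum_add_distrib, ← Finset.sum_sub_distrib]
    exact Finset.sum_congr rfl fun p _ => Finset.sum_congr rfl fun q _ => by ring
  rw [hsum, h1, h2, ← hθ, ← hθ']
  ring

end IsPeriodicCurve

end RankFormula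

/-! ### The sign of theta and the form on the reduced Grothendieck group -/

section GrothendieckGroup

open IsLocalRing Module

variable {A : Type u} [CommRing A] [IsLocalRing A]

namespace IsPeriodicCurve

/-- Rank differences are additive and kill `[A]`. The value `0` away from the minimal primes lets a
family be chosen for all pairs; the clause for `p = q` removes the diagonal weights, which are not
covered by the positivity result. -/
theorem exists_rankDiff (H : IsPeriodicCurve A) (p q : PrimeSpectrum A) :
    ∃ d : RationalReducedG0 A →ₗ[ℚ] ℚ, (p = q → d = 0) ∧ (p ∈ H.minimalSpectrum → q ∈ H.minimalSpectrum →
      ∀ (M : Type u) [AddCommGroup M] [Module A M] [Module.Finite A M],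
        d (RationalReducedG0.cls A M) = rankAtStalk M p - rankAtStalk M q) := by
  by_cases hpq : p = q
  · exact ⟨0, fun _ => rfl, fun _ _ M _ _ _ => by rw [hpq, sub_self, LinearMap.zero_apply]⟩
  by_cases hp : p ∈ H.minimalSpectrum
  swap
  · exact ⟨0, fun _ => rfl, fun h => absurd h hp⟩
  by_cases hq : q ∈ H.minimalSpectrum
  swap
  · exact ⟨0, fun _ => rfl, fun _ h => absurd h hq⟩
  let d₀ : FreeAbelianGroup (FGModuleCat.{u} A) →+ ℚ :=
    FreeAbelianGroup.lift fun M => rankAtStalk M p - rankAtStalk M q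
  have hd₀ (M : FGModuleCat.{u} A) :
      d₀ (FreeAbelianGroup.of M) = rankAtStalk M p - rankAtStalk M q :=
    FreeAbelianGroup.lift_apply_of _ _
  have hrel : G0Relations A ≤ d₀.ker := by
    rw [G0Relations, AddSubgroup.closure_le]
    rintro _ ⟨M', M, M'', f, g, hf, hfg, hg, rfl⟩
    rw [SetLike.mem_coe, AddMonoidHom.mem_ker, map_sub, map_sub, hd₀, hd₀, hd₀,
      H.rankAtStalk_add_of_exact hp hf hfg hg, H.rankAtStalk_add_of_exact hq hf hfg hg]
    push_cast
    ring
  let d₁ : G0 A →+ ℚ := QuotientAddGroup.lift (G0Relations A) d₀ hrel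
  have hd₁ (M : Type u) [AddCommGroup M] [Module A M] [Module.Finite A M] :
      d₁ (G0.cls A M) = rankAtStalk M p - rankAtStalk M q := hd₀ (FGModuleCat.of A M)
  have hA : AddSubgroup.zmultiples (G0.cls A A) ≤ d₁.ker := by
    rw [AddSubgroup.zmultiples_le, AddMonoidHom.mem_ker, hd₁, rankAtStalk_self]
    simp
  let d₂ : ReducedG0 A →+ ℚ := QuotientAddGroup.lift _ d₁ hA
  refine ⟨LinearMap.liftBaseChange ℚ d₂.toIntLinearMap, fun h => absurd h hpq, fun _ _ M _ _ _ => ?_⟩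
  rw [RationalReducedG0.cls, LinearMap.liftBaseChange_tmul, one_smul]
  exact hd₁ M

theorem hochsterTheta_self_nonpos (H : IsPeriodicCurve A) (M : Type u) [AddCommGroup M]
    [Module A M] [Module.Finite A M] :
    hochsterTheta A 1 M M ≤ 0 ∧ (hochsterTheta A 1 M M = 0 ↔ HasConstantMinimalRank A M) := by
  have h := H.neg_two_mul_hochsterTheta M M
  have hnonneg (p : PrimeSpectrum A) (hp : p ∈ H.minimalSpectrum) (q : PrimeSpectrum A)
      (hq : q ∈ H.minimalSpectrum) : 0 ≤ hochsterTheta A 1 (A ⧸ p.asIdeal) (A ⧸ q.asIdeal) *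
        (((rankAtStalk M p : ℤ) - rankAtStalk M q) * (rankAtStalk M p - rankAtStalk M q)) := by
    by_cases hpq : p = q
    · rw [hpq, sub_self, zero_mul, mul_zero]
    · exact mul_nonneg (H.hochsterTheta_quotient_pos hp hq hpq).le (mul_self_nonneg _)
  have hnonneg' (p : PrimeSpectrum A) (hp : p ∈ H.minimalSpectrum) :=
    Finset.sum_nonneg (hnonneg p hp)
  refine ⟨by linarith [Finset.sum_nonneg hnonneg'], fun h0 p q hp hq => ?_, fun hconst => ?_⟩
  · rw [← H.mem_minimalSpectrum] at hp hq
    by_cases hpq : p = q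
    · rw [hpq]
    rw [h0, mul_zero, eq_comm, Finset.sum_eq_zero_iff_of_nonneg hnonneg'] at h
    have h2 := (Finset.sum_eq_zero_iff_of_nonneg (hnonneg p hp)).mp (h p hp) q hq
    have h3 := mul_self_eq_zero.mp
      ((mul_eq_zero.mp h2).resolve_left (H.hochsterTheta_quotient_pos hp hq hpq).ne')
    exact_mod_cast sub_eq_zero.mp h3
  · have hz : -2 * hochsterTheta A 1 M M = 0 := h.trans <|
      Finset.sum_eq_zero fun p hp => Finset.sum_eq_zero fun q hq => by
        rw [hconst p q (H.mem_minimalSpectrum.mp hp) (H.mem_minimalSpectrum.mp hq), sub_self,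
          zero_mul, mul_zero]
    linarith

theorem exists_bilinForm (H : IsPeriodicCurve A) :
    ∃ B : LinearMap.BilinForm ℚ (RationalReducedG0 A),
      (∀ (M : Type u) [AddCommGroup M] [Module A M] [Module.Finite A M]
          (N : Type u) [AddCommGroup N] [Module A N] [Module.Finite A N],
          B (RationalReducedG0.cls A M) (RationalReducedG0.cls A N) =
            (hochsterTheta A 1 M N : ℚ)) ∧
      (-B).IsPosSemidef := by
  choose d hd₀ hd using H.exists_rankDiff
  -- The form is built from the rank differences and is `-2` times theta on classes of modules;
  -- being a sum of squares with nonnegative weights, it is visibly semidefinite.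
  let B : LinearMap.BilinForm ℚ (RationalReducedG0 A) :=
    ∑ p ∈ H.minimalSpectrum, ∑ q ∈ H.minimalSpectrum,
      (hochsterTheta A 1 (A ⧸ p.asIdeal) (A ⧸ q.asIdeal) : ℚ) •
        LinearMap.BilinForm.linMulLin (d p q) (d p q)
  have hB (x y : RationalReducedG0 A) : B x y = ∑ p ∈ H.minimalSpectrum, ∑ q ∈ H.minimalSpectrum,
      (hochsterTheta A 1 (A ⧸ p.asIdeal) (A ⧸ q.asIdeal) : ℚ) * (d p q x * d p q y) := by
    simp [B, LinearMap.sum_apply]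
  have hBM (M N : Type u) [AddCommGroup M] [Module A M] [Module.Finite A M] [AddCommGroup N]
      [Module A N] [Module.Finite A N] :
      B (RationalReducedG0.cls A M) (RationalReducedG0.cls A N) = -2 * hochsterTheta A 1 M N := by
    have h : ((-2 * hochsterTheta A 1 M N : ℤ) : ℚ) = _ :=
      congrArg Int.cast (H.neg_two_mul_hochsterTheta M N)
    push_cast at h
    rw [h, hB]
    exact Finset.sum_congr rfl fun p hp => Finset.sum_congr rfl fun q hq => by
      rw [hd p q hp hq, hd p q hp hq]
  refine ⟨-((1 / 2 : ℚ) • B), fun M _ _ _ N _ _ _ => ?_, ?_⟩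
  · rw [LinearMap.neg_apply, LinearMap.neg_apply, LinearMap.smul_apply, LinearMap.smul_apply, hBM,
      smul_eq_mul]
    ring
  · rw [neg_neg]
    refine LinearMap.BilinForm.IsPosSemidef.smul
      (LinearMap.BilinForm.isPosSemidef_def.mpr ⟨⟨fun x y => ?_⟩, ⟨fun x => ?_⟩⟩) (by norm_num)
    · simp only [hB, mul_comm (d _ _ x)]
    · rw [hB]
      refine Finset.sum_nonneg fun p hp => Finset.sum_nonneg fun q hq => ?_
      by_cases hpq : p = q
      · rw [hd₀ p q hpq, LinearMap.zero_apply, zero_mul, mul_zero]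
      · exact mul_nonneg (by exact_mod_cast (H.hochsterTheta_quotient_pos hp hq hpq).le)
          (mul_self_nonneg _)

end IsPeriodicCurve

end GrothendieckGroup

theorem mainTheorem10 (A : Type u) [CommRing A] [IsLocalRing A]
    (hA : IsLocalHypersurface A) (hsing : HasIsolatedSingularity A)
    (hdim : ringKrullDim A = 1) :
    -- the lengths in the definition of `θ^A` are finite
    (∀ (M : Type u) [AddCommGroup M] [Module A M] [Module.Finite A M]
        (N : Type u) [AddCommGroup N] [Module A N] [Module.Finite A N] (i : ℕ),
        ringKrullDim A < (i : WithBot ℕ∞) → Module.length A (torModule A i M N) ≠ ⊤) ∧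
    -- `θ^A` does not depend on `e`
    (∀ (M : Type u) [AddCommGroup M] [Module A M] [Module.Finite A M]
        (N : Type u) [AddCommGroup N] [Module A N] [Module.Finite A N] (e e' : ℕ),
        ringKrullDim A ≤ ((2 * e : ℕ) : WithBot ℕ∞) →
        ringKrullDim A ≤ ((2 * e' : ℕ) : WithBot ℕ∞) →
        hochsterTheta A e M N = hochsterTheta A e' M N) ∧
    ∀ e : ℕ, ringKrullDim A ≤ ((2 * e : ℕ) : WithBot ℕ∞) →
      (∀ (M : Type u) [AddCommGroup M] [Module A M] [Module.Finite A M],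
        hochsterTheta A e M M ≤ 0 ∧
        (hochsterTheta A e M M = 0 ↔ HasConstantMinimalRank A M)) ∧
      -- `θ^A` induces a symmetric negative semidefinite form on the rational reduced group
      ∃ B : LinearMap.BilinForm ℚ (RationalReducedG0 A),
        (∀ (M : Type u) [AddCommGroup M] [Module A M] [Module.Finite A M]
            (N : Type u) [AddCommGroup N] [Module A N] [Module.Finite A N],
            B (RationalReducedG0.cls A M) (RationalReducedG0.cls A N) =
              (hochsterTheta A e M N : ℚ)) ∧
        (-B).IsPosSemidef := by
  have H := hA.isPeriodicCurve hsing hdim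
  have hθ (e : ℕ) (he : ringKrullDim A ≤ ((2 * e : ℕ) : WithBot ℕ∞)) (M N : Type u)
      [AddCommGroup M] [Module A M] [Module.Finite A M] [AddCommGroup N] [Module A N] :
      hochsterTheta A e M N = hochsterTheta A 1 M N := by
    -- Dimension one rules out `e = 0`, the index at which periodicity would not apply.
    obtain _ | e := e
    · rw [hdim] at he
      norm_num at he
    · exact H.hochsterTheta_succ e M N
  refine ⟨fun M _ _ _ N _ _ _ i hi => ?_, fun M _ _ _ N _ _ _ e e' he he' => ?_,
    fun e he => ⟨fun M _ _ _ => ?_, ?_⟩⟩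
  · obtain _ | i := i
    · rw [hdim] at hi
      norm_num at hi
    · exact H.length_tor_ne_top i M N
  · rw [hθ e he, hθ e' he']
  · rw [hθ e he]
    exact H.hochsterTheta_self_nonpos M
  · obtain ⟨B, hB, hpos⟩ := H.exists_bilinForm
    exact ⟨B, fun M _ _ _ N _ _ _ => by rw [hθ e he, hB], hpos⟩
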